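/- Let $k>0$ be real and let $\rho,\beta,\gamma,\omega\in\mathbb{C}$ with $\Re\rho>0$ and $\Re\beta>0$. Put $m=\lfloor \Re\beta/k\rfloor+1$ (so $m=\lfloor\beta/k\rfloor+1$ if $\beta$ is real). Let $a\in\mathbb{R}$ and $a<b\le\infty$. Write $\Gamma_k(z)=k^{z/k-1}\Gamma(z/k)$ (with $1/\Gamma_k(z)=0$ at $z=0,-k,-2k,\dots$), $(\gamma)_{n,k}=\gamma(\gamma+k)\cdots(\gamma+(n-1)k)$, and $$E^{\gamma}_{k,\rho,\beta}(z)=\sum_{n=0}^{\infty}\frac{(\gamma)_{n,k}\,z^n}{\Gamma_k(\rho n+\beta)\,n!}.$$ The $k$-Prabhakar integral and the $k$-Prabhakar derivative with base point $a$ are $$(\mathbf{P}^{\gamma}_{\beta}f)(x)=\int_a^x\frac{(x-t)^{\beta/k-1}}{k}E^{\gamma}_{k,\rho,\beta}\bigl(\omega(x-t)^{\rho/k}\bigr)f(t)\,dt,\qquad (\mathbf{D}^{\gamma}_{\beta}f)(x)=\Bigl(\frac{d}{dx}\Bigr)^{m}\Bigl(k^m\,\mathbf{P}^{-\gamma}_{mk-\beta}f\Bigr)(x),$$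 where $k,\rho,\omega,a$ are the same throughout. Let $f$ be a complex-valued function on $(a,b)$ that is continuous and (Lebesgue) integrable on $(a,b)$. 1. The integral $(\mathbf{P}^{\gamma}_{\beta}f)(x)$ converges absolutely for every $x\in(a,b)$, $\mathbf{P}^{\gamma}_{\beta}f$ is integrable on $(a,y)$ for every real $y$ with $a<y\le b$, the derivative $\mathbf{D}^{\gamma}_{\beta}\mathbf{P}^{\gamma}_{\beta}f$ exists on $(a,b)$, and $(\mathbf{D}^{\gamma}_{\beta}\mathbf{P}^{\gamma}_{\beta}f)(x)=f(x)$ for all $x\in(a,b)$. 2. If $\mathbf{D}^{\gamma}_{\beta}f$ exists on $(a,b)$ and is continuous and integrable on $(a,b)$, then the integral $(\mathbf{P}^{\gamma}_{\beta}\mathbf{D}^{\gamma}_{\beta}f)(x)$ converges absolutely for every $x\in(a,b)$, and there are constants $c_0,\dots,c_{m-1}\in\mathbb{C}$ such that for all $x\in(a,b)$ $$(\mathbf{P}^{\gamma}_{\beta}\mathbf{D}^{\gamma}_{\beta}f)(x)=f(x)+\sum_{j=0}^{m-1}c_j\,(x-a)^{\beta/k-1-j}\,E^{\gamma}_{k,\rho,\beta-jk}\bigl(\omega(x-a)^{\rho/k}\bigr).$$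 The constants can be chosen with $c_{m-1}=0$ if $\Re\beta=(m-1)k$, and, if $\rho,\beta,\gamma,\omega$ are real and $f$ is real-valued, with $c_j\in\mathbb{R}$ for all $j$ (both at the same time). -/

import Mathlib

open Set MeasureTheory

/-- The `k`-Gamma function `Γ_k(z) = k^(z/k - 1) Γ(z/k)`, which for `Re z > 0` is
`∫ t in (0, ∞), t^(z-1) exp (-t^k/k)`. At its poles `z = 0, -k, -2k, …` it takes Mathlib's
value `0`, so that `1 / Γ_k` is the usual entire function, which vanishes there. -/
noncomputable def kGamma (k : ℝ) (z : ℂ) : ℂ :=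
  (k : ℂ) ^ (z / k - 1) * Complex.Gamma (z / k)

/-- The Pochhammer `k`-symbol `(γ)_{n,k} = γ (γ + k) ⋯ (γ + (n-1)k)`, which is
`Γ_k(γ + nk) / Γ_k(γ)`, understood as a limit where `Γ_k` has poles. -/
noncomputable def kPochhammer (k : ℝ) (γ : ℂ) (n : ℕ) : ℂ :=
  ∏ i ∈ Finset.range n, (γ + (i : ℂ) * k)

/-- The `k`-Mittag-Leffler function `E_{k,ρ,β}^γ(z)`. -/
noncomputable def kMittagLeffler (k : ℝ) (ρ β γ z : ℂ) : ℂ :=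
  ∑' n : ℕ, kPochhammer k γ n * z ^ n / (kGamma k (ρ * n + β) * (n.factorial : ℂ))

/-- The convolution kernel of the `k`-Prabhakar integral,
`t^(β/k - 1) / k * E_{k,ρ,β}^γ(ω t^(ρ/k))` for `t > 0` and `0` for `t ≤ 0`. -/
noncomputable def kPrabhakarKernel (k : ℝ) (ρ β γ ω : ℂ) (t : ℝ) : ℂ :=
  if 0 < t then
    (t : ℂ) ^ (β / k - 1) / k * kMittagLeffler k ρ β γ (ω * (t : ℂ) ^ (ρ / k))
  else 0

/-- The `k`-Prabhakar integral with base point `a`. -/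
noncomputable def kPrabhakarIntegral (k : ℝ) (ρ β γ ω : ℂ) (a : ℝ) (f : ℝ → ℂ) (x : ℝ) : ℂ :=
  ∫ t in a..x, kPrabhakarKernel k ρ β γ ω (x - t) * f t

/-- The integral that defines the `k`-Prabhakar integral of `f` at `x` converges absolutely. -/
def KPrabhakarIntegrableAt (k : ℝ) (ρ β γ ω : ℂ) (a : ℝ) (f : ℝ → ℂ) (x : ℝ) : Prop :=
  IntervalIntegrable (fun t => kPrabhakarKernel k ρ β γ ω (x - t) * f t) volume a x

/-- The number of differentiations `m = [β/k] + 1` in the `k`-Prabhakar derivative. For complex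
`β` the integer part of `β/k` is that of its real part. -/
noncomputable def kPrabhakarOrder (k : ℝ) (β : ℂ) : ℕ :=
  ⌊β.re / k⌋₊ + 1

/-- The function `k^m P_{ρ, mk-β, ω}^{-γ} f`, whose `m`-th derivative is the `k`-Prabhakar
derivative of `f`. -/
noncomputable def kPrabhakarPrimitive (k : ℝ) (ρ β γ ω : ℂ) (a : ℝ) (f : ℝ → ℂ) (x : ℝ) : ℂ :=
  (k : ℂ) ^ kPrabhakarOrder k β *
    kPrabhakarIntegral k ρ ((kPrabhakarOrder k β : ℂ) * k - β) (-γ) ω a f x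

/-- The `k`-Prabhakar derivative `(d/dx)^m (k^m P_{ρ, mk-β, ω}^{-γ} f)` with base point `a`. -/
noncomputable def kPrabhakarDeriv (k : ℝ) (ρ β γ ω : ℂ) (a : ℝ) (f : ℝ → ℂ) (x : ℝ) : ℂ :=
  iteratedDeriv (kPrabhakarOrder k β) (kPrabhakarPrimitive k ρ β γ ω a f) x

/-- The `k`-Prabhakar derivative of `f` exists at every point of the open set `s`: the integral
that is to be differentiated converges, and it is `m` times differentiable on `s`. -/
def KPrabhakarDifferentiableOn (k : ℝ) (ρ β γ ω : ℂ) (a : ℝ) (f : ℝ → ℂ) (s : Set ℝ) : Prop :=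
  (∀ x ∈ s, KPrabhakarIntegrableAt k ρ ((kPrabhakarOrder k β : ℂ) * k - β) (-γ) ω a f x) ∧
    ∀ i < kPrabhakarOrder k β,
      DifferentiableOn ℝ (iteratedDeriv i (kPrabhakarPrimitive k ρ β γ ω a f)) s

/-- The open interval `(a, b)` of the real line, where `b` may be `∞`. -/
def openInterval (a : ℝ) (b : EReal) : Set ℝ :=
  {x : ℝ | a < x ∧ (x : EReal) < b}

/-- The class `C(a, b) ∩ L(a, b)`. -/
def ContinuousIntegrableOn (f : ℝ → ℂ) (s : Set ℝ) : Prop :=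
  ContinuousOn f s ∧ IntegrableOn f s volume

open Filter Topology Convolution

open scoped ComplexConjugate

/-! Write e(β, γ) for the kernel of the integral, with k, ρ and ω fixed. Everything rests on the
semigroup law e(β₁, γ₁) * e(β₂, γ₂) = e(β₁ + β₂, γ₁ + γ₂) for Re β₁, Re β₂ > 0
(`volterra_kPrabhakarKernel`). The kernel is a series of Riemann–Liouville kernels. These convolve
by the Beta integral, and the coefficients combine by Chu–Vandermonde. Associativity of convolution
carries the law over to the integral operators. It holds at every point, because continuous
integrable functions form a class stable under Volterra convolution.

For γ = 0 only the zeroth term survives, so k^n P^0_{nk} is the n-fold integral J^n. Hence k^m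
P^{-γ}_{mk-β} P^γ_β f = J^m f, and m differentiations return f.

For the second part let φ = D f and let F be the primitive of f. The m-th derivative of F - J^m φ
vanishes, so this difference is a polynomial ∑ d_j (x-a)^j of degree below m. The primitive operator
sends P φ to J^m φ and, by the semigroup law, sends e(β - ik, γ)(x - a) to a multiple of
(x-a)^(m-1-i). It is injective, since P^γ_β after it gives J^m. Therefore f is P φ plus a
combination of these kernels.

Only i = m-1 can fail Re(β - ik) > 0, namely if Re β = (m-1)k. Then Re(mk - β) = k, so the kernel
defining F is bounded near 0. This forces F and J^m φ to tend to 0 at a, whence d_0 = 0 and the bad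
kernel drops out. For real data, complex conjugation fixes both sides, so each c_j may be replaced
by its real part. -/

/-! ### Convolution of causal functions -/

/-- Integrable functions on the line that vanish up to `a` and are continuous on `(a, a + T)`. -/
structure IsCausal {𝕜 : Type*} [RCLike 𝕜] (a T : ℝ) (f : ℝ → 𝕜) : Prop where
  integrable : Integrable f
  continuousOn : ContinuousOn f (Ioo a (a + T))
  eq_zero : ∀ x ≤ a, f x = 0

theorem IsCausal.norm {𝕜 : Type*} [RCLike 𝕜] {a T : ℝ} {f : ℝ → 𝕜} (hf : IsCausal a T f) :
    IsCausal a T (fun x => ‖f x‖) :=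
  ⟨hf.integrable.norm, hf.continuousOn.norm, fun x hx => by simp [hf.eq_zero x hx]⟩

theorem continuous_smul_of_tsupport_subset {𝕜 : Type*} [RCLike 𝕜] {U : Set ℝ} (hU : IsOpen U)
    {χ : ℝ → ℝ} {f : ℝ → 𝕜} (hχ : Continuous χ) (hs : tsupport χ ⊆ U) (hf : ContinuousOn f U) :
    Continuous (fun x => χ x • f x) := by
  refine continuous_of_tsupport fun x hx => ?_
  have hxU : x ∈ U := hs (tsupport_smul_subset_left χ f hx)
  exact hχ.continuousAt.smul (hf.continuousAt (hU.mem_nhds hxU))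

/-- Cut f by a bump χ equal to 1 near x₀. Where χ t ≠ 1 and a < t < x, the point t lies well to the
left of x, so x - t stays away from 0 and K may be cut off by a second bump η. Each of the two
products then has one continuous, compactly supported factor and one integrable factor, which gives
existence and continuity of the convolution near x₀. -/
theorem IsCausal.exists_splitting {𝕜 : Type*} [RCLike 𝕜] {a T : ℝ} {f K : ℝ → 𝕜}
    (hf : IsCausal a T f) (hK : IsCausal 0 T K) {x₀ : ℝ} (hx₀ : x₀ ∈ Ioo a (a + T)) :
    ∃ f₁ f₂ K₂ : ℝ → 𝕜, (Continuous f₁ ∧ HasCompactSupport f₁) ∧ Integrable f₂ ∧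
      (Continuous K₂ ∧ HasCompactSupport K₂) ∧
      ∀ᶠ x in 𝓝 x₀, ∀ t, f t * K (x - t) = f₁ t * K (x - t) + f₂ t * K₂ (x - t) := by
  obtain ⟨h1, h2⟩ := hx₀
  obtain ⟨ε, hε, hε1, hε2⟩ : ∃ ε > 0, a < x₀ - ε ∧ x₀ + ε < a + T := by
    refine ⟨min (x₀ - a) (a + T - x₀) / 2, ?_, ?_, ?_⟩
    · have : 0 < min (x₀ - a) (a + T - x₀) := lt_min (by linarith) (by linarith)
      linarith
    · have := min_le_left (x₀ - a) (a + T - x₀)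
      linarith
    · have := min_le_right (x₀ - a) (a + T - x₀)
      linarith
  obtain ⟨χ, hχ1, hχc, hχs, hχ⟩ := exists_continuousMap_one_of_isCompact_subset_isOpen
    (isCompact_Icc (a := x₀ - ε) (b := x₀ + ε)) (isOpen_Ioo (a := a) (b := a + T))
    (Icc_subset_Ioo hε1 hε2)
  obtain ⟨η, hη1, hηc, hηs, hη⟩ := exists_continuousMap_one_of_isCompact_subset_isOpen
    (isCompact_Icc (a := ε / 2) (b := x₀ + ε - a)) (isOpen_Ioo (a := (0 : ℝ)) (b := 0 + T))
    (Icc_subset_Ioo (by linarith) (by linarith))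
  refine ⟨fun t => χ t • f t, fun t => (1 - χ t) • f t, fun t => η t • K t, ⟨?_, ?_⟩, ?_,
    ⟨?_, ?_⟩, ?_⟩
  · exact continuous_smul_of_tsupport_subset isOpen_Ioo χ.continuous hχs hf.continuousOn
  · exact (HasCompactSupport.smul_right (f := χ) (f' := f) hχc)
  · refine hf.integrable.bdd_smul (φ := fun t => 1 - χ t) 1
      (by fun_prop : Continuous fun t => 1 - χ t).aestronglyMeasurable (ae_of_all _ fun t => ?_)
    rw [Real.norm_eq_abs, abs_le]
    constructor <;> linarith [(hχ t).1, (hχ t).2]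
  · exact continuous_smul_of_tsupport_subset isOpen_Ioo η.continuous hηs hK.continuousOn
  · exact (HasCompactSupport.smul_right (f := η) (f' := K) hηc)
  · filter_upwards [Ioo_mem_nhds (show x₀ - ε / 2 < x₀ by linarith)
      (show x₀ < x₀ + ε / 2 by linarith)] with x hx t
    have key : ((1 - χ t) • f t) * K (x - t) = ((1 - χ t) • f t) * (η (x - t) • K (x - t)) := by
      rcases le_or_gt t a with hta | hta
      · simp [hf.eq_zero t hta]
      rcases le_or_gt (x - t) 0 with hxt | hxt
      · simp [hK.eq_zero _ hxt]
      rcases lt_or_ge t (x₀ - ε) with ht | ht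
      · have : η (x - t) = 1 := hη1 ⟨by linarith [hx.1], by linarith [hx.2]⟩
        simp [this]
      · have : χ t = 1 := hχ1 ⟨ht, by linarith [hx.2]⟩
        simp [this]
    rw [← key, ← add_mul, ← add_smul]
    simp

theorem IsCausal.convolutionExistsAt_and_continuousAt {𝕜 : Type*} [RCLike 𝕜] {a T : ℝ}
    {f K : ℝ → 𝕜} (hf : IsCausal a T f) (hK : IsCausal 0 T K) {x₀ : ℝ} (hx₀ : x₀ ∈ Ioo a (a + T)) :
    ConvolutionExistsAt f K x₀ (ContinuousLinearMap.mul 𝕜 𝕜) ∧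
      ContinuousAt (f ⋆[ContinuousLinearMap.mul 𝕜 𝕜] K) x₀ := by
  obtain ⟨f₁, f₂, K₂, ⟨h1, h1'⟩, h2, ⟨h3, h3'⟩, h⟩ := hf.exists_splitting hK hx₀
  have e1 : ConvolutionExists f₁ K (ContinuousLinearMap.mul 𝕜 𝕜) :=
    h1'.convolutionExists_left _ h1 hK.integrable.locallyIntegrable
  have e2 : ConvolutionExists f₂ K₂ (ContinuousLinearMap.mul 𝕜 𝕜) :=
    h3'.convolutionExists_right _ h2.locallyIntegrable h3
  have c1 := h1'.continuous_convolution_left (ContinuousLinearMap.mul 𝕜 𝕜) h1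
    hK.integrable.locallyIntegrable
  have c2 := h3'.continuous_convolution_right (ContinuousLinearMap.mul 𝕜 𝕜)
    h2.locallyIntegrable h3
  constructor
  · refine ((e1 x₀).integrable.add (e2 x₀).integrable).congr (ae_of_all _ fun t => ?_)
    simpa using (h.self_of_nhds t).symm
  · refine (c1.add c2).continuousAt.congr ?_
    filter_upwards [h] with x hx
    rw [Pi.add_apply, convolution_def, convolution_def, convolution_def,
      ← integral_add (e1 x).integrable (e2 x).integrable]
    refine integral_congr_ae (ae_of_all _ fun t => ?_)
    simpa using (hx t).symm

theorem IsCausal.convolution {𝕜 : Type*} [RCLike 𝕜] {a T : ℝ} {f K : ℝ → 𝕜}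
    (hf : IsCausal a T f) (hK : IsCausal 0 T K) :
    IsCausal a T (f ⋆[ContinuousLinearMap.mul 𝕜 𝕜] K) := by
  refine ⟨hf.integrable.integrable_convolution _ hK.integrable, fun x hx =>
    (hf.convolutionExistsAt_and_continuousAt hK hx).2.continuousWithinAt,
    fun x hx => ?_⟩
  rw [convolution_def, ← integral_zero ℝ 𝕜]
  refine integral_congr_ae (ae_of_all _ fun t => ?_)
  rcases le_or_gt t a with ht | ht
  · simp [hf.eq_zero t ht]
  · simp [hK.eq_zero (x - t) (by linarith)]

/-- Associativity at a given point needs absolute convergence of the triple integral there. This is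
the existence of |f| * (|K₁| * |K₂|) at x, which holds because the class is stable under norms and
convolution. -/
theorem IsCausal.convolution_assoc {a T : ℝ} {f K₁ K₂ : ℝ → ℂ}
    (hf : IsCausal a T f) (h₁ : IsCausal 0 T K₁) (h₂ : IsCausal 0 T K₂) {x : ℝ}
    (hx : x ∈ Ioo a (a + T)) :
    ((f ⋆[ContinuousLinearMap.mul ℂ ℂ] K₁) ⋆[ContinuousLinearMap.mul ℂ ℂ] K₂) x =
      (f ⋆[ContinuousLinearMap.mul ℂ ℂ] (K₁ ⋆[ContinuousLinearMap.mul ℂ ℂ] K₂)) x := by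
  refine MeasureTheory.convolution_assoc _ _ _ _ (fun x y z => by simp [mul_assoc])
    hf.integrable.aestronglyMeasurable h₁.integrable.aestronglyMeasurable
    h₂.integrable.aestronglyMeasurable (hf.integrable.ae_convolution_exists _ h₁.integrable)
    (h₁.integrable.norm.ae_convolution_exists _ h₂.integrable.norm) ?_
  exact (hf.norm.convolutionExistsAt_and_continuousAt
    (h₁.norm.convolution h₂.norm) hx).1

theorem ContinuousIntegrableOn.isCausal {a T : ℝ} {f : ℝ → ℂ}
    (hf : ContinuousIntegrableOn f (Ioo a (a + T))) :
    IsCausal a T ((Ioo a (a + T)).indicator f) :=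
  ⟨hf.2.integrable_indicator measurableSet_Ioo,
    hf.1.congr fun _ hx => indicator_of_mem hx f,
    fun _ hx => indicator_of_notMem (fun h => not_lt.2 hx h.1) f⟩

theorem ContinuousIntegrableOn.mono {f : ℝ → ℂ} {s t : Set ℝ} (hf : ContinuousIntegrableOn f t)
    (hst : s ⊆ t) : ContinuousIntegrableOn f s :=
  ⟨hf.1.mono hst, hf.2.mono_set hst⟩

theorem ContinuousIntegrableOn.congr {f g : ℝ → ℂ} {s : Set ℝ} (hs : MeasurableSet s)
    (hf : ContinuousIntegrableOn f s) (h : EqOn g f s) : ContinuousIntegrableOn g s :=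
  ⟨hf.1.congr h, hf.2.congr_fun h.symm hs⟩

/-! ### Volterra convolution on an interval -/

/-- The Volterra convolution with kernel `K` and base point `a`. -/
noncomputable def volterra (K : ℝ → ℂ) (a : ℝ) (f : ℝ → ℂ) (x : ℝ) : ℂ :=
  ∫ t in a..x, K (x - t) * f t

/-- For a < t < x both cutoffs are inactive, and for any other t one of them vanishes. So the
integral from a to x is a convolution on the whole line. -/
theorem volterra_integrand_eq {a T x : ℝ} (K f : ℝ → ℂ) (hx : x ∈ Ioo a (a + T)) :
    (Ioo a x).indicator (fun t => K (x - t) * f t) =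
      fun t => (Ioo a (a + T)).indicator f t * (Ioo 0 (0 + T)).indicator K (x - t) := by
  funext t
  obtain ⟨h1, h2⟩ := hx
  by_cases ht : t ∈ Ioo a x
  · rw [indicator_of_mem ht, indicator_of_mem (show t ∈ Ioo a (a + T) from ⟨ht.1, by linarith [ht.2]⟩),
      indicator_of_mem (show x - t ∈ Ioo 0 (0 + T) from
        ⟨by linarith [ht.2], by linarith [ht.1]⟩), mul_comm]
  · rw [indicator_of_notMem ht]
    by_cases h : a < t
    · have : x - t ∉ Ioo 0 (0 + T) := fun h' => ht ⟨h, by linarith [h'.1]⟩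
      rw [indicator_of_notMem this]; simp
    · have : t ∉ Ioo a (a + T) := fun h' => h h'.1
      rw [indicator_of_notMem this]; simp

theorem volterra_eq_convolution {a T x : ℝ} (K f : ℝ → ℂ) (hx : x ∈ Ioo a (a + T)) :
    volterra K a f x = ((Ioo a (a + T)).indicator f ⋆[ContinuousLinearMap.mul ℂ ℂ]
      (Ioo 0 (0 + T)).indicator K) x := by
  rw [volterra, intervalIntegral.integral_of_le hx.1.le, integral_Ioc_eq_integral_Ioo,
    ← integral_indicator measurableSet_Ioo, volterra_integrand_eq K f hx]
  rfl

theorem intervalIntegrable_volterra {a T x : ℝ} {K f : ℝ → ℂ}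
    (hK : ContinuousIntegrableOn K (Ioo 0 T)) (hf : ContinuousIntegrableOn f (Ioo a (a + T)))
    (hx : x ∈ Ioo a (a + T)) :
    IntervalIntegrable (fun t => K (x - t) * f t) volume a x := by
  rw [intervalIntegrable_iff_integrableOn_Ioo_of_le hx.1.le,
    ← integrable_indicator_iff measurableSet_Ioo, volterra_integrand_eq K f hx]
  have hK' : ContinuousIntegrableOn K (Ioo 0 (0 + T)) := by rwa [zero_add]
  exact (hf.isCausal.convolutionExistsAt_and_continuousAt hK'.isCausal hx).1

theorem ContinuousIntegrableOn.volterra {a T : ℝ} {K f : ℝ → ℂ}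
    (hK : ContinuousIntegrableOn K (Ioo 0 T)) (hf : ContinuousIntegrableOn f (Ioo a (a + T))) :
    ContinuousIntegrableOn (volterra K a f) (Ioo a (a + T)) := by
  have hK' : ContinuousIntegrableOn K (Ioo 0 (0 + T)) := by rwa [zero_add]
  have h := hf.isCausal.convolution hK'.isCausal
  exact ContinuousIntegrableOn.congr measurableSet_Ioo ⟨h.continuousOn, h.integrable.integrableOn⟩
    fun x hx => volterra_eq_convolution K f hx

/-- Before a + T, the convolution sees f only on (a, a + T) and K only on (0, T). This allows the
cutoffs beyond T to be changed between successive convolutions. -/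
theorem IsCausal.convolution_congr {a T : ℝ} {f g K L : ℝ → ℂ}
    (hf : ∀ x ≤ a, f x = 0) (hg : ∀ x ≤ a, g x = 0)
    (hK : ∀ x ≤ 0, K x = 0) (hL : ∀ x ≤ 0, L x = 0) (hfg : EqOn f g (Ioo a (a + T)))
    (hKL : EqOn K L (Ioo 0 T)) {x : ℝ} (hx : x ∈ Ioo a (a + T)) :
    (f ⋆[ContinuousLinearMap.mul ℂ ℂ] K) x = (g ⋆[ContinuousLinearMap.mul ℂ ℂ] L) x := by
  rw [convolution_def, convolution_def]
  refine integral_congr_ae (ae_of_all _ fun t => ?_)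
  rcases le_or_gt t a with hta | hta
  · simp [hf t hta, hg t hta]
  rcases le_or_gt (x - t) 0 with hxt | hxt
  · simp [hK _ hxt, hL _ hxt]
  · have h1 := hfg ⟨hta, show t < a + T by linarith [hx.2]⟩
    have h2 := hKL ⟨hxt, show x - t < T by linarith [hx.2]⟩
    simp [h1, h2]

/-- As convolutions the left side is (f ⋆ K₂) ⋆ K₁ and the kernel K₃ is K₂ ⋆ K₁, up to cutoffs, so
associativity suffices and no commutativity is needed. -/
theorem volterra_volterra {a T : ℝ} {K₁ K₂ K₃ f : ℝ → ℂ}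
    (h₁ : ContinuousIntegrableOn K₁ (Ioo 0 T)) (h₂ : ContinuousIntegrableOn K₂ (Ioo 0 T))
    (hf : ContinuousIntegrableOn f (Ioo a (a + T)))
    (h : ∀ u ∈ Ioo 0 T, volterra K₁ 0 K₂ u = K₃ u) {x : ℝ} (hx : x ∈ Ioo a (a + T)) :
    volterra K₁ a (volterra K₂ a f) x = volterra K₃ a f x := by
  have h₁' : ContinuousIntegrableOn K₁ (Ioo 0 (0 + T)) := by rwa [zero_add]
  have h₂' : ContinuousIntegrableOn K₂ (Ioo 0 (0 + T)) := by rwa [zero_add]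
  have ind0 : ∀ (c : ℝ) (g : ℝ → ℂ), ∀ y ≤ c, (Ioo c (c + T)).indicator g y = 0 :=
    fun c g y hy => indicator_of_notMem (fun h => not_lt.2 hy h.1) g
  rw [volterra_eq_convolution _ _ hx, volterra_eq_convolution _ _ hx]
  calc _ = (((Ioo a (a + T)).indicator f ⋆[ContinuousLinearMap.mul ℂ ℂ]
          (Ioo 0 (0 + T)).indicator K₂) ⋆[ContinuousLinearMap.mul ℂ ℂ]
            (Ioo 0 (0 + T)).indicator K₁) x := by
        refine IsCausal.convolution_congr (ind0 _ _) (hf.isCausal.convolution h₂'.isCausal).eq_zero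
          (ind0 _ _) (ind0 _ _) (fun y hy => ?_) (fun _ _ => rfl) hx
        rw [indicator_of_mem hy, volterra_eq_convolution _ _ hy]
    _ = _ := hf.isCausal.convolution_assoc h₂'.isCausal h₁'.isCausal hx
    _ = _ := by
        refine IsCausal.convolution_congr (ind0 _ _) (ind0 _ _)
          (h₂'.isCausal.convolution h₁'.isCausal).eq_zero (ind0 _ _) (fun _ _ => rfl)
          (fun y hy => ?_) hx
        have hy' : y ∈ Ioo 0 (0 + T) := by rwa [zero_add]
        rw [indicator_of_mem hy', ← h y hy, volterra_eq_convolution _ _ hy']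

theorem volterra_comp_sub (K g : ℝ → ℂ) (a x : ℝ) :
    volterra K a (fun t => g (t - a)) x = volterra K 0 g (x - a) := by
  have := intervalIntegral.integral_comp_sub_right (a := a) (b := x)
    (fun t => K (x - a - t) * g t) a
  simp only [sub_self] at this
  rw [volterra, volterra, ← this]
  simp

/-! ### Pochhammer symbols and Chu–Vandermonde -/

theorem kPochhammer_zero (k : ℝ) (γ : ℂ) : kPochhammer k γ 0 = 1 := by simp [kPochhammer]

theorem kPochhammer_succ (k : ℝ) (γ : ℂ) (n : ℕ) :
    kPochhammer k γ (n + 1) = kPochhammer k γ n * (γ + n * k) := by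
  simp [kPochhammer, Finset.prod_range_succ]

theorem kPochhammer_zero_left (k : ℝ) (n : ℕ) : kPochhammer k 0 (n + 1) = 0 := by
  simp [kPochhammer, Finset.prod_range_succ']

/-- Pascal's rule raises either index of a pair (i, j), and the two new factors add up to (γ + ik) +
(δ + jk) = γ + δ + nk, the next factor on the right. -/
theorem sum_antidiagonal_choose_mul_kPochhammer (k : ℝ) (γ δ : ℂ) (n : ℕ) :
    ∑ p ∈ Finset.HasAntidiagonal.antidiagonal n,
        (n.choose p.1 : ℂ) * (kPochhammer k γ p.1 * kPochhammer k δ p.2) =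
      kPochhammer k (γ + δ) n := by
  induction n with
  | zero => simp [kPochhammer_zero]
  | succ n ih =>
    rw [Finset.sum_antidiagonal_choose_succ_mul
      (fun i j => kPochhammer k γ i * kPochhammer k δ j) n, kPochhammer_succ, ← ih, Finset.sum_mul,
      ← Finset.sum_add_distrib]
    refine Finset.sum_congr rfl fun p hp => ?_
    rw [Finset.HasAntidiagonal.mem_antidiagonal] at hp
    rw [← hp, Nat.choose_symm_add, kPochhammer_succ, kPochhammer_succ]
    push_cast
    ring

/-- The Chu–Vandermonde identity. -/
theorem sum_antidiagonal_kPochhammer_div_factorial (k : ℝ) (γ δ : ℂ) (n : ℕ) :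
    ∑ p ∈ Finset.HasAntidiagonal.antidiagonal n, kPochhammer k γ p.1 / (p.1.factorial : ℂ) *
      (kPochhammer k δ p.2 / (p.2.factorial : ℂ)) =
      kPochhammer k (γ + δ) n / (n.factorial : ℂ) := by
  rw [← sum_antidiagonal_choose_mul_kPochhammer, Finset.sum_div]
  refine Finset.sum_congr rfl fun p hp => ?_
  rw [Finset.HasAntidiagonal.mem_antidiagonal] at hp
  have h : ((n.choose p.1 : ℕ) : ℂ) * p.1.factorial * p.2.factorial = n.factorial := by
    rw [← hp]
    rw [Nat.choose_symm_add]
    exact_mod_cast Nat.add_choose_mul_factorial_mul_factorial p.1 p.2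
  have h1 : (p.1.factorial : ℂ) ≠ 0 := by exact_mod_cast p.1.factorial_ne_zero
  have h2 : (p.2.factorial : ℂ) ≠ 0 := by exact_mod_cast p.2.factorial_ne_zero
  have h3 : (n.factorial : ℂ) ≠ 0 := by exact_mod_cast n.factorial_ne_zero
  rw [div_mul_div_comm, div_eq_div_iff (mul_ne_zero h1 h2) h3, ← h]
  ring

/-! ### Convergence of the Mittag-Leffler series -/

/-- The integrand is that of n = 0 times x^(nr), whose modulus is at most 1 and tends to 0 on (0,
1), so dominated convergence applies. This yields the decay of Γ-ratios needed for the ratio test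
without Stirling's formula. -/
theorem tendsto_betaIntegral_nat_mul_add {r μ : ℂ} (hr : 0 < r.re) (hμ : 0 < μ.re) :
    Tendsto (fun n : ℕ => Complex.betaIntegral (n * r + μ) r) atTop (𝓝 0) := by
  have h0 : (∫ _ in (0 : ℝ)..1, (0 : ℂ)) = 0 := by simp
  have hre : ∀ n : ℕ, (n * r + μ - 1).re = n * r.re + (μ.re - 1) := fun n => by
    simp; ring
  have hsplit : ∀ n : ℕ, ∀ x ∈ Ioo (0 : ℝ) 1,
      ‖(x : ℂ) ^ ((n : ℂ) * r + μ - 1) * (1 - (x : ℂ)) ^ (r - 1)‖ =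
        (x ^ r.re) ^ n * ‖(x : ℂ) ^ (μ - 1) * (1 - (x : ℂ)) ^ (r - 1)‖ := fun n x hx => by
    rw [norm_mul, norm_mul, Complex.norm_cpow_eq_rpow_re_of_pos hx.1,
      Complex.norm_cpow_eq_rpow_re_of_pos hx.1, hre, Real.rpow_add hx.1, mul_comm (n : ℝ),
      Real.rpow_mul hx.1.le, Real.rpow_natCast]
    simp [mul_assoc]
  have hae : ∀ᵐ x : ℝ, x ∈ uIoc (0 : ℝ) 1 → x ∈ Ioo (0 : ℝ) 1 := by
    have h1 : ∀ᵐ x : ℝ, x ≠ 1 := by simp [ae_iff, measure_singleton]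
    filter_upwards [h1] with x hx hx'
    rw [uIoc_of_le zero_le_one] at hx'
    exact ⟨hx'.1, lt_of_le_of_ne hx'.2 hx⟩
  rw [← h0]
  refine intervalIntegral.tendsto_integral_filter_of_dominated_convergence
    (fun x => ‖(x : ℂ) ^ (μ - 1) * (1 - (x : ℂ)) ^ (r - 1)‖) (Eventually.of_forall fun n => ?_)
    (Eventually.of_forall fun n => ?_) (Complex.betaIntegral_convergent hμ hr).norm ?_
  · refine (Complex.betaIntegral_convergent ?_ hr).def'.aestronglyMeasurable
    simp only [Complex.add_re, Complex.mul_re, Complex.natCast_re, Complex.natCast_im, zero_mul,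
      sub_zero]
    positivity
  · filter_upwards [hae] with x hx hx'
    rw [hsplit n x (hx hx')]
    exact mul_le_of_le_one_left (norm_nonneg _) (pow_le_one₀ (Real.rpow_nonneg (hx hx').1.le _)
      (Real.rpow_le_one (hx hx').1.le (hx hx').2.le hr.le))
  · filter_upwards [hae] with x hx hx'
    rw [tendsto_zero_iff_norm_tendsto_zero]
    simp_rw [fun n => hsplit n x (hx hx')]
    have := (tendsto_pow_atTop_nhds_zero_of_lt_one (Real.rpow_nonneg (hx hx').1.le r.re)
      (Real.rpow_lt_one (hx hx').1.le (hx hx').2 hr)).mul_const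
      ‖(x : ℂ) ^ (μ - 1) * (1 - (x : ℂ)) ^ (r - 1)‖
    simpa using this

theorem tendsto_Gamma_div_Gamma_add {r μ : ℂ} (hr : 0 < r.re) (hμ : 0 < μ.re) :
    Tendsto (fun n : ℕ => Complex.Gamma (n * r + μ) / Complex.Gamma (n * r + μ + r)) atTop
      (𝓝 0) := by
  have h := (tendsto_betaIntegral_nat_mul_add hr hμ).div_const (Complex.Gamma r)
  rw [zero_div] at h
  refine h.congr fun n => ?_
  have hn : 0 < ((n : ℂ) * r + μ).re := by
    simp only [Complex.add_re, Complex.mul_re, Complex.natCast_re, Complex.natCast_im, zero_mul,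
      sub_zero]
    positivity
  have hn' : 0 < ((n : ℂ) * r + μ + r).re := by rw [Complex.add_re]; positivity
  rw [div_eq_div_iff (Complex.Gamma_ne_zero_of_re_pos hr) (Complex.Gamma_ne_zero_of_re_pos hn'),
    Complex.Gamma_mul_Gamma_eq_betaIntegral hn hr, mul_comm]

/-- The terms of the series of the `k`-Mittag-Leffler function. -/
noncomputable def kMittagLefflerTerm (k : ℝ) (ρ β γ z : ℂ) (n : ℕ) : ℂ :=
  kPochhammer k γ n * z ^ n / (kGamma k (ρ * n + β) * (n.factorial : ℂ))

theorem re_nat_mul_add_pos {ρ β : ℂ} (hρ : 0 < ρ.re) (hβ : 0 < β.re) (n : ℕ) :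
    0 < (ρ * n + β).re := by
  simp only [Complex.add_re, Complex.mul_re, Complex.natCast_re, Complex.natCast_im, mul_zero,
    sub_zero]
  positivity

/-- Written with (γ + nk)/(n + 1) = k + (γ - k)/(n + 1), the ratio of successive terms is a bounded
factor times a Γ-ratio that tends to 0. -/
theorem kMittagLefflerTerm_succ {k : ℝ} (hk : 0 < k) {ρ β : ℂ} (hρ : 0 < ρ.re) (hβ : 0 < β.re)
    (γ z : ℂ) (n : ℕ) :
    kMittagLefflerTerm k ρ β γ z (n + 1) =
      ((k + (γ - k) / (n + 1)) * (z / (k : ℂ) ^ (ρ / k)) *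
        (Complex.Gamma (n * (ρ / k) + β / k) / Complex.Gamma (n * (ρ / k) + β / k + ρ / k))) *
      kMittagLefflerTerm k ρ β γ z n := by
  have hk' : (k : ℂ) ≠ 0 := by exact_mod_cast hk.ne'
  have e1 : (ρ * n + β) / k = n * (ρ / k) + β / k := by field_simp
  have e2 : (ρ * (n + 1 : ℕ) + β) / k = n * (ρ / k) + β / k + ρ / k := by
    push_cast; field_simp
    ring
  have g1 : Complex.Gamma (n * (ρ / k) + β / k) ≠ 0 := by
    rw [← e1]
    refine Complex.Gamma_ne_zero_of_re_pos ?_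
    rw [Complex.div_ofReal_re]; exact div_pos (re_nat_mul_add_pos hρ hβ n) hk
  have g2 : Complex.Gamma (n * (ρ / k) + β / k + ρ / k) ≠ 0 := by
    rw [← e2]
    refine Complex.Gamma_ne_zero_of_re_pos ?_
    rw [Complex.div_ofReal_re]; exact div_pos (re_nat_mul_add_pos hρ hβ (n + 1)) hk
  have p1 : ∀ s : ℂ, (k : ℂ) ^ s ≠ 0 := fun s => by simp [Complex.cpow_eq_zero_iff, hk']
  have hn : (n : ℂ) + 1 ≠ 0 := by exact_mod_cast n.succ_ne_zero
  have hf : (n.factorial : ℂ) ≠ 0 := by exact_mod_cast n.factorial_ne_zero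
  rw [kMittagLefflerTerm, kMittagLefflerTerm, kGamma, kGamma, e1, e2, kPochhammer_succ,
    Nat.factorial_succ,
    show (n * (ρ / k) + β / k + ρ / k - 1 : ℂ) = (n * (ρ / k) + β / k - 1) + ρ / k by ring,
    Complex.cpow_add _ _ hk']
  have q1 := p1 (n * (ρ / k) + β / k - 1)
  have q2 := p1 (ρ / k)
  generalize (k : ℂ) ^ (n * (ρ / k) + β / k - 1) = A at *
  generalize (k : ℂ) ^ (ρ / k) = B at *
  generalize Complex.Gamma (n * (ρ / k) + β / k) = C at *
  generalize Complex.Gamma (n * (ρ / k) + β / k + ρ / k) = D at *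
  push_cast
  field_simp
  ring

theorem summable_norm_kMittagLefflerTerm {k : ℝ} (hk : 0 < k) {ρ β : ℂ} (hρ : 0 < ρ.re)
    (hβ : 0 < β.re) (γ z : ℂ) : Summable fun n => ‖kMittagLefflerTerm k ρ β γ z n‖ := by
  have h1 : Tendsto (fun n : ℕ => (k : ℂ) + (γ - k) / (n + 1)) atTop (𝓝 (k + (γ - k) * 0)) := by
    refine tendsto_const_nhds.add ?_
    simp_rw [div_eq_mul_one_div (γ - (k : ℂ))]
    exact tendsto_const_nhds.mul tendsto_one_div_add_atTop_nhds_zero_nat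
  have h2 := (h1.mul_const (z / (k : ℂ) ^ (ρ / k))).mul
    (tendsto_Gamma_div_Gamma_add (r := ρ / k) (μ := β / k)
      (by rw [Complex.div_ofReal_re]; positivity) (by rw [Complex.div_ofReal_re]; positivity))
  rw [mul_zero] at h2
  have h3 := h2.norm.eventually_le_const (show ‖(0 : ℂ)‖ < 1 / 2 by simp)
  refine summable_of_ratio_norm_eventually_le (r := 1 / 2) (by norm_num) ?_
  filter_upwards [h3] with n hn
  rw [kMittagLefflerTerm_succ hk hρ hβ, norm_norm, norm_norm, norm_mul]
  exact mul_le_mul_of_nonneg_right hn (norm_nonneg _)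

theorem norm_kMittagLefflerTerm_le_of_norm_le (k : ℝ) (ρ β γ : ℂ) {z w : ℂ} (h : ‖z‖ ≤ ‖w‖)
    (n : ℕ) : ‖kMittagLefflerTerm k ρ β γ z n‖ ≤ ‖kMittagLefflerTerm k ρ β γ w n‖ := by
  simp only [kMittagLefflerTerm, norm_div, norm_mul, norm_pow]
  gcongr

theorem norm_kMittagLeffler_le {k : ℝ} (hk : 0 < k) {ρ β : ℂ} (hρ : 0 < ρ.re)
    (hβ : 0 < β.re) (γ : ℂ) {z w : ℂ} (h : ‖z‖ ≤ ‖w‖) :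
    ‖kMittagLeffler k ρ β γ z‖ ≤ ∑' n, ‖kMittagLefflerTerm k ρ β γ w n‖ :=
  tsum_of_norm_bounded (summable_norm_kMittagLefflerTerm hk hρ hβ γ w).hasSum
    (norm_kMittagLefflerTerm_le_of_norm_le k ρ β γ h)

theorem continuous_kMittagLeffler {k : ℝ} (hk : 0 < k) {ρ β : ℂ} (hρ : 0 < ρ.re)
    (hβ : 0 < β.re) (γ : ℂ) : Continuous (kMittagLeffler k ρ β γ) := by
  rw [continuous_iff_continuousAt]
  intro z
  have h : ContinuousOn (kMittagLeffler k ρ β γ) (Metric.ball 0 (‖z‖ + 1)) := by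
    refine continuousOn_tsum (fun n => ?_)
      (summable_norm_kMittagLefflerTerm hk hρ hβ γ ((‖z‖ + 1 : ℝ) : ℂ)) fun n w hw =>
        norm_kMittagLefflerTerm_le_of_norm_le k ρ β γ ?_ n
    · fun_prop
    · rw [mem_ball_zero_iff] at hw
      rw [Complex.norm_real, Real.norm_of_nonneg (by positivity)]
      exact hw.le
  exact h.continuousAt (Metric.isOpen_ball.mem_nhds (by simp))

/-! ### Bounds and continuity of the kernel -/

theorem norm_omega_mul_cpow_le {ω r : ℂ} (hr : 0 < r.re) {t T : ℝ} (ht : 0 < t) (htT : t ≤ T) :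
    ‖ω * (t : ℂ) ^ r‖ ≤ ‖ω * (T : ℂ) ^ r‖ := by
  rw [norm_mul, norm_mul, Complex.norm_cpow_eq_rpow_re_of_pos ht,
    Complex.norm_cpow_eq_rpow_re_of_pos (ht.trans_le htT)]
  gcongr

theorem kPrabhakarKernel_of_pos (k : ℝ) (ρ β γ ω : ℂ) {t : ℝ} (ht : 0 < t) :
    kPrabhakarKernel k ρ β γ ω t =
      (t : ℂ) ^ (β / k - 1) / k * kMittagLeffler k ρ β γ (ω * (t : ℂ) ^ (ρ / k)) :=
  if_pos ht

theorem exists_norm_kPrabhakarKernel_le {k : ℝ} (hk : 0 < k) {ρ β : ℂ} (hρ : 0 < ρ.re)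
    (hβ : 0 < β.re) (γ ω : ℂ) (T : ℝ) :
    ∃ C, 0 ≤ C ∧ ∀ t ∈ Ioc 0 T, ‖kPrabhakarKernel k ρ β γ ω t‖ ≤ C * t ^ (β.re / k - 1) := by
  refine ⟨k⁻¹ * ∑' n, ‖kMittagLefflerTerm k ρ β γ (ω * (T : ℂ) ^ (ρ / k)) n‖, ?_, ?_⟩
  · exact mul_nonneg (inv_nonneg.2 hk.le) (tsum_nonneg fun n => norm_nonneg _)
  intro t ht
  have hr : 0 < (ρ / k).re := by rw [Complex.div_ofReal_re]; positivity
  have h := norm_kMittagLeffler_le hk hρ hβ γ (norm_omega_mul_cpow_le (ω := ω) hr ht.1 ht.2)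
  rw [kPrabhakarKernel_of_pos _ _ _ _ _ ht.1, norm_mul, norm_div,
    Complex.norm_cpow_eq_rpow_re_of_pos ht.1, Complex.norm_real, Real.norm_of_nonneg hk.le,
    Complex.sub_re, Complex.div_ofReal_re, Complex.one_re, div_eq_inv_mul, mul_right_comm]
  have := Real.rpow_nonneg ht.1.le (β.re / k - 1)
  gcongr

theorem continuousOn_kPrabhakarKernel {k : ℝ} (hk : 0 < k) {ρ β : ℂ} (hρ : 0 < ρ.re)
    (hβ : 0 < β.re) (γ ω : ℂ) : ContinuousOn (kPrabhakarKernel k ρ β γ ω) (Ioi 0) := by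
  have hc : ∀ s : ℂ, ContinuousOn (fun t : ℝ => (t : ℂ) ^ s) (Ioi 0) := fun s t ht =>
    (Complex.continuousAt_ofReal_cpow_const t s (Or.inr (ne_of_gt ht))).continuousWithinAt
  have h : ContinuousOn (fun t : ℝ => (t : ℂ) ^ (β / k - 1) / k *
      kMittagLeffler k ρ β γ (ω * (t : ℂ) ^ (ρ / k))) (Ioi 0) :=
    ((hc _).div_const _).mul ((continuous_kMittagLeffler hk hρ hβ γ).comp_continuousOn
      (continuousOn_const.mul (hc _)))
  exact h.congr fun t ht => kPrabhakarKernel_of_pos _ _ _ _ _ ht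

theorem continuousIntegrableOn_cpow {s : ℂ} (hs : 0 < s.re) (T : ℝ) :
    ContinuousIntegrableOn (fun t : ℝ => (t : ℂ) ^ (s - 1)) (Ioo 0 T) := by
  refine ⟨fun t ht => (Complex.continuousAt_ofReal_cpow_const t _
    (Or.inr (ne_of_gt ht.1))).continuousWithinAt, ?_⟩
  rcases le_total T 0 with h | h
  · simp [Ioo_eq_empty_of_le h]
  rw [← intervalIntegrable_iff_integrableOn_Ioo_of_le h]
  exact intervalIntegral.intervalIntegrable_cpow' (by simpa using hs)

theorem continuousIntegrableOn_kPrabhakarKernel {k : ℝ} (hk : 0 < k) {ρ β : ℂ} (hρ : 0 < ρ.re)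
    (hβ : 0 < β.re) (γ ω : ℂ) (T : ℝ) :
    ContinuousIntegrableOn (kPrabhakarKernel k ρ β γ ω) (Ioo 0 T) := by
  have hc := (continuousOn_kPrabhakarKernel hk hρ hβ γ ω).mono
    (Ioo_subset_Ioi_self : Ioo 0 T ⊆ Ioi 0)
  obtain ⟨C, -, hC⟩ := exists_norm_kPrabhakarKernel_le hk hρ hβ γ ω T
  have hs : 0 < (β / k).re := by rw [Complex.div_ofReal_re]; positivity
  refine ⟨hc, ((continuousIntegrableOn_cpow hs T).2.norm.const_mul C).mono'
    (hc.aestronglyMeasurable measurableSet_Ioo) ?_⟩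
  filter_upwards [ae_restrict_mem measurableSet_Ioo] with t ht
  rw [Complex.norm_cpow_eq_rpow_re_of_pos ht.1, Complex.sub_re, Complex.div_ofReal_re,
    Complex.one_re]
  exact hC t ⟨ht.1, ht.2.le⟩

/-! ### Riemann–Liouville expansion and the semigroup law -/

/-- The kernel `k^(-s) t^(s-1) / Γ(s)` of the `k`-Riemann–Liouville integral of order `s k`. -/
noncomputable def riemannLiouvilleKernel (k : ℝ) (s : ℂ) (t : ℝ) : ℂ :=
  (k : ℂ) ^ (-s) * (t : ℂ) ^ (s - 1) / Complex.Gamma s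

theorem volterra_riemannLiouvilleKernel {k : ℝ} (hk : 0 < k) {s₁ s₂ : ℂ} (h₁ : 0 < s₁.re)
    (h₂ : 0 < s₂.re) {u : ℝ} (hu : 0 < u) :
    volterra (riemannLiouvilleKernel k s₁) 0 (riemannLiouvilleKernel k s₂) u =
      riemannLiouvilleKernel k (s₁ + s₂) u := by
  have hk' : (k : ℂ) ≠ 0 := by exact_mod_cast hk.ne'
  have e : ∀ t : ℝ, riemannLiouvilleKernel k s₁ (u - t) * riemannLiouvilleKernel k s₂ t =
      ((k : ℂ) ^ (-s₁) * (k : ℂ) ^ (-s₂) / (Complex.Gamma s₁ * Complex.Gamma s₂)) *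
        ((t : ℂ) ^ (s₂ - 1) * ((u : ℂ) - t) ^ (s₁ - 1)) := fun t => by
    simp only [riemannLiouvilleKernel]
    push_cast
    ring
  have g1 := Complex.Gamma_ne_zero_of_re_pos h₁
  have g2 := Complex.Gamma_ne_zero_of_re_pos h₂
  have g3 := Complex.Gamma_ne_zero_of_re_pos (s := s₁ + s₂) (by rw [Complex.add_re]; positivity)
  have hB := Complex.Gamma_mul_Gamma_eq_betaIntegral h₂ h₁
  rw [add_comm s₂ s₁] at hB
  rw [volterra]
  simp_rw [e]
  rw [intervalIntegral.integral_const_mul, Complex.betaIntegral_scaled _ _ hu, add_comm s₂ s₁,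
    riemannLiouvilleKernel, neg_add, Complex.cpow_add _ _ hk']
  rw [div_mul_eq_mul_div, div_eq_div_iff (mul_ne_zero g1 g2) g3, mul_comm (Complex.Gamma s₁), hB]
  ring

theorem cpow_mul_kMittagLefflerTerm {k : ℝ} (hk : 0 < k) (ρ β γ ω : ℂ) {t : ℝ} (ht : 0 < t)
    (n : ℕ) :
    (t : ℂ) ^ (β / k - 1) / k * kMittagLefflerTerm k ρ β γ (ω * (t : ℂ) ^ (ρ / k)) n =
      kPochhammer k γ n / (n.factorial : ℂ) *
        (ω ^ n * riemannLiouvilleKernel k ((ρ * n + β) / k) t) := by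
  have hk' : (k : ℂ) ≠ 0 := by exact_mod_cast hk.ne'
  have ht' : (t : ℂ) ≠ 0 := by exact_mod_cast ht.ne'
  have e : ((ρ * n + β) / k - 1 : ℂ) = (β / k - 1) + n * (ρ / k) := by ring
  rw [kMittagLefflerTerm, riemannLiouvilleKernel, kGamma, mul_pow, ← Complex.cpow_nat_mul, e,
    Complex.cpow_add _ _ ht', ← e, Complex.cpow_sub _ _ hk', Complex.cpow_one, Complex.cpow_neg]
  have hp : (k : ℂ) ^ ((ρ * n + β) / k) ≠ 0 := by simp [Complex.cpow_eq_zero_iff, hk']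
  generalize (k : ℂ) ^ ((ρ * n + β) / k) = A at *
  field_simp

theorem hasSum_kPrabhakarKernel {k : ℝ} (hk : 0 < k) {ρ β : ℂ} (hρ : 0 < ρ.re) (hβ : 0 < β.re)
    (γ ω : ℂ) {t : ℝ} (ht : 0 < t) :
    HasSum (fun n : ℕ => kPochhammer k γ n / (n.factorial : ℂ) *
      (ω ^ n * riemannLiouvilleKernel k ((ρ * n + β) / k) t)) (kPrabhakarKernel k ρ β γ ω t) := by
  rw [kPrabhakarKernel_of_pos _ _ _ _ _ ht]
  simp_rw [← cpow_mul_kMittagLefflerTerm hk _ _ _ _ ht]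
  exact (summable_norm_kMittagLefflerTerm hk hρ hβ γ _).of_norm.hasSum.mul_left _

theorem norm_cpow_mul_kMittagLefflerTerm_le {k : ℝ} (hk : 0 < k) {ρ : ℂ} (hρ : 0 < ρ.re)
    (β γ ω : ℂ) {t u : ℝ} (ht : 0 < t) (htu : t ≤ u) (n : ℕ) :
    ‖kPochhammer k γ n / (n.factorial : ℂ) *
        (ω ^ n * riemannLiouvilleKernel k ((ρ * n + β) / k) t)‖ ≤
      ‖kMittagLefflerTerm k ρ β γ (ω * (u : ℂ) ^ (ρ / k)) n‖ / k * ‖(t : ℂ) ^ (β / k - 1)‖ := by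
  have hr : 0 < (ρ / k).re := by rw [Complex.div_ofReal_re]; positivity
  rw [← cpow_mul_kMittagLefflerTerm hk _ _ _ _ ht, norm_mul, norm_div, Complex.norm_real,
    Real.norm_of_nonneg hk.le, div_mul_eq_mul_div, div_mul_eq_mul_div, mul_comm]
  have := norm_kMittagLefflerTerm_le_of_norm_le k ρ β γ
    (norm_omega_mul_cpow_le (ω := ω) hr ht htu) n
  gcongr

theorem continuousOn_riemannLiouvilleKernel (k : ℝ) (s : ℂ) :
    ContinuousOn (riemannLiouvilleKernel k s) (Ioi 0) := by
  have hc : ContinuousOn (fun t : ℝ => (t : ℂ) ^ (s - 1)) (Ioi 0) := fun t ht =>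
    (Complex.continuousAt_ofReal_cpow_const t _ (Or.inr (ne_of_gt ht))).continuousWithinAt
  exact (continuousOn_const.mul hc).div_const _

/-- Both kernels are expanded and the product is integrated term by term. The (i, j) term is
dominated by M₁ i * M₂ j * w t, where M₁ and M₂ are summable term sizes taken at the endpoint u and
w is a Beta-type integrand. -/
theorem hasSum_volterra_kPrabhakarKernel {k : ℝ} (hk : 0 < k) {ρ β₁ β₂ : ℂ} (hρ : 0 < ρ.re)
    (h₁ : 0 < β₁.re) (h₂ : 0 < β₂.re) (γ₁ γ₂ ω : ℂ) {u : ℝ} (hu : 0 < u) :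
    HasSum (fun p : ℕ × ℕ => kPochhammer k γ₁ p.1 / (p.1.factorial : ℂ) *
        (kPochhammer k γ₂ p.2 / (p.2.factorial : ℂ)) *
          (ω ^ (p.1 + p.2) *
            riemannLiouvilleKernel k ((ρ * (p.1 + p.2 : ℕ) + (β₁ + β₂)) / k) u))
      (volterra (kPrabhakarKernel k ρ β₁ γ₁ ω) 0 (kPrabhakarKernel k ρ β₂ γ₂ ω) u) := by
  set F : ℕ × ℕ → ℝ → ℂ := fun p t =>
    (kPochhammer k γ₁ p.1 / (p.1.factorial : ℂ) *
        (ω ^ p.1 * riemannLiouvilleKernel k ((ρ * p.1 + β₁) / k) (u - t))) *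
      (kPochhammer k γ₂ p.2 / (p.2.factorial : ℂ) *
        (ω ^ p.2 * riemannLiouvilleKernel k ((ρ * p.2 + β₂) / k) t)) with hF
  set M₁ : ℕ → ℝ := fun n => ‖kMittagLefflerTerm k ρ β₁ γ₁ (ω * (u : ℂ) ^ (ρ / k)) n‖ / k with hM₁
  set M₂ : ℕ → ℝ := fun n => ‖kMittagLefflerTerm k ρ β₂ γ₂ (ω * (u : ℂ) ^ (ρ / k)) n‖ / k with hM₂
  have hsM₁ : Summable M₁ := (summable_norm_kMittagLefflerTerm hk hρ h₁ γ₁ _).div_const k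
  have hsM₂ : Summable M₂ := (summable_norm_kMittagLefflerTerm hk hρ h₂ γ₂ _).div_const k
  have hM : Summable fun p : ℕ × ℕ => M₁ p.1 * M₂ p.2 :=
    hsM₁.mul_of_nonneg hsM₂ (fun n => div_nonneg (norm_nonneg _) hk.le)
      (fun n => div_nonneg (norm_nonneg _) hk.le)
  set w : ℝ → ℝ := fun t => ‖((u - t : ℝ) : ℂ) ^ (β₁ / k - 1) * (t : ℂ) ^ (β₂ / k - 1)‖ with hw
  have hae : ∀ᵐ t : ℝ, t ∈ uIoc 0 u → t ∈ Ioo 0 u := by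
    have h1 : ∀ᵐ t : ℝ, t ≠ u := by simp [ae_iff, measure_singleton]
    filter_upwards [h1] with t ht ht'
    rw [uIoc_of_le hu.le] at ht'
    exact ⟨ht'.1, lt_of_le_of_ne ht'.2 ht⟩
  have hs : ∀ {β : ℂ}, 0 < β.re → 0 < (β / k).re := fun h => by
    rw [Complex.div_ofReal_re]; positivity
  have hwint : IntervalIntegrable w volume 0 u := by
    -- The length 2u serves only to make u an interior point.
    have hu2 : u ∈ Ioo (0 : ℝ) (0 + 2 * u) := ⟨hu, by linarith⟩
    exact (intervalIntegrable_volterra (continuousIntegrableOn_cpow (hs h₁) (2 * u))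
      (continuousIntegrableOn_cpow (hs h₂) (0 + 2 * u)) hu2).norm
  have key := intervalIntegral.hasSum_integral_of_dominated_convergence (μ := volume)
    (a := 0) (b := u) (F := F)
    (f := fun t => kPrabhakarKernel k ρ β₁ γ₁ ω (u - t) * kPrabhakarKernel k ρ β₂ γ₂ ω t)
    (fun p t => M₁ p.1 * M₂ p.2 * w t) ?_ ?_ ?_ ?_ ?_
  · have hint : ∀ p, ∫ t in (0 : ℝ)..u, F p t =
        kPochhammer k γ₁ p.1 / (p.1.factorial : ℂ) *
        (kPochhammer k γ₂ p.2 / (p.2.factorial : ℂ)) *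
          (ω ^ (p.1 + p.2) *
            riemannLiouvilleKernel k ((ρ * (p.1 + p.2 : ℕ) + (β₁ + β₂)) / k) u) := fun p => by
      have e : ∀ t, F p t = (kPochhammer k γ₁ p.1 / (p.1.factorial : ℂ) *
          (kPochhammer k γ₂ p.2 / (p.2.factorial : ℂ)) * ω ^ (p.1 + p.2)) *
          (riemannLiouvilleKernel k ((ρ * p.1 + β₁) / k) (u - t) *
            riemannLiouvilleKernel k ((ρ * p.2 + β₂) / k) t) := fun t => by
        simp only [hF]; ring
      have := volterra_riemannLiouvilleKernel hk (hs (re_nat_mul_add_pos hρ h₁ p.1))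
        (hs (re_nat_mul_add_pos hρ h₂ p.2)) hu
      rw [volterra] at this
      simp_rw [e]
      rw [intervalIntegral.integral_const_mul, this, mul_assoc]
      congr 3
      push_cast
      ring
    rw [volterra]
    exact key.congr_fun fun p => (hint p).symm
  · intro p
    rw [uIoc_of_le hu.le, ← Measure.restrict_congr_set Ioo_ae_eq_Ioc]
    refine ContinuousOn.aestronglyMeasurable ?_ measurableSet_Ioo
    refine ContinuousOn.mul (continuousOn_const.mul (continuousOn_const.mul ?_))
      (continuousOn_const.mul (continuousOn_const.mul ?_))
    · exact (continuousOn_riemannLiouvilleKernel k _).comp (by fun_prop)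
        fun t ht => sub_pos.2 ht.2
    · exact (continuousOn_riemannLiouvilleKernel k _).mono fun t ht => ht.1
  · intro p
    filter_upwards [hae] with t ht ht'
    have h := ht ht'
    have e : M₁ p.1 * M₂ p.2 * w t = (M₁ p.1 * ‖((u - t : ℝ) : ℂ) ^ (β₁ / k - 1)‖) *
        (M₂ p.2 * ‖(t : ℂ) ^ (β₂ / k - 1)‖) := by
      simp only [hw, norm_mul]; ring
    rw [e]
    exact (norm_mul_le _ _).trans <| mul_le_mul
      (norm_cpow_mul_kMittagLefflerTerm_le hk hρ β₁ γ₁ ω (sub_pos.2 h.2)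
      (by linarith [h.1]) _) (norm_cpow_mul_kMittagLefflerTerm_le hk hρ β₂ γ₂ ω h.1 h.2.le _)
      (norm_nonneg _) (mul_nonneg (div_nonneg (norm_nonneg _) hk.le) (norm_nonneg _))
  · exact ae_of_all _ fun t _ => hM.mul_right _
  · simp_rw [tsum_mul_right]
    exact hwint.const_mul _
  · filter_upwards [hae] with t ht ht'
    have h := ht ht'
    have s1 := hasSum_kPrabhakarKernel hk hρ h₁ γ₁ ω (sub_pos.2 h.2)
    have s2 := hasSum_kPrabhakarKernel hk hρ h₂ γ₂ ω h.1
    have s3 := summable_mul_of_summable_norm s1.summable.norm s2.summable.norm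
    have h4 := HasSum.mul s1 s2 s3
    exact h4

/-- The power of ω and the Riemann–Liouville index depend only on the sum of the two summation
indices, so summing along antidiagonals leaves the Chu–Vandermonde coefficient. -/
theorem volterra_kPrabhakarKernel {k : ℝ} (hk : 0 < k) {ρ β₁ β₂ : ℂ} (hρ : 0 < ρ.re)
    (h₁ : 0 < β₁.re) (h₂ : 0 < β₂.re) (γ₁ γ₂ ω : ℂ) {u : ℝ} (hu : 0 < u) :
    volterra (kPrabhakarKernel k ρ β₁ γ₁ ω) 0 (kPrabhakarKernel k ρ β₂ γ₂ ω) u =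
      kPrabhakarKernel k ρ (β₁ + β₂) (γ₁ + γ₂) ω u := by
  have h := hasSum_volterra_kPrabhakarKernel hk hρ h₁ h₂ γ₁ γ₂ ω hu
  rw [← Finset.HasAntidiagonal.sigmaAntidiagonalEquivProd.hasSum_iff] at h
  have h' := h.sigma fun n => hasSum_fintype _
  refine h'.unique ?_
  refine (hasSum_kPrabhakarKernel hk hρ (β := β₁ + β₂) (by rw [Complex.add_re]; positivity)
    (γ₁ + γ₂) ω hu).congr_fun fun n => ?_
  rw [← sum_antidiagonal_kPochhammer_div_factorial, Finset.sum_mul,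
    ← Finset.sum_coe_sort (Finset.HasAntidiagonal.antidiagonal n)]
  refine Finset.sum_congr rfl fun p _ => ?_
  obtain ⟨⟨i, j⟩, hp⟩ := p
  obtain rfl : i + j = n := Finset.HasAntidiagonal.mem_antidiagonal.1 hp
  rfl

/-! ### Composition of Prabhakar integrals -/

theorem kPrabhakarIntegrableAt_of_mem_Ioo {k : ℝ} (hk : 0 < k) {ρ β : ℂ} (hρ : 0 < ρ.re)
    (hβ : 0 < β.re) (γ ω : ℂ) {a y x : ℝ} {f : ℝ → ℂ} (hf : ContinuousIntegrableOn f (Ioo a y))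
    (hx : x ∈ Ioo a y) : KPrabhakarIntegrableAt k ρ β γ ω a f x := by
  obtain ⟨T, rfl⟩ : ∃ T, y = a + T := ⟨y - a, by ring⟩
  exact intervalIntegrable_volterra (continuousIntegrableOn_kPrabhakarKernel hk hρ hβ γ ω T) hf hx

theorem ContinuousIntegrableOn.kPrabhakarIntegral {k : ℝ} (hk : 0 < k) {ρ β : ℂ} (hρ : 0 < ρ.re)
    (hβ : 0 < β.re) (γ ω : ℂ) {a y : ℝ} {f : ℝ → ℂ} (hf : ContinuousIntegrableOn f (Ioo a y)) :
    ContinuousIntegrableOn (kPrabhakarIntegral k ρ β γ ω a f) (Ioo a y) := by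
  obtain ⟨T, rfl⟩ : ∃ T, y = a + T := ⟨y - a, by ring⟩
  exact (continuousIntegrableOn_kPrabhakarKernel hk hρ hβ γ ω T).volterra hf

theorem kPrabhakarIntegral_kPrabhakarIntegral {k : ℝ} (hk : 0 < k) {ρ β₁ β₂ : ℂ} (hρ : 0 < ρ.re)
    (h₁ : 0 < β₁.re) (h₂ : 0 < β₂.re) (γ₁ γ₂ ω : ℂ) {a y x : ℝ} {f : ℝ → ℂ}
    (hf : ContinuousIntegrableOn f (Ioo a y)) (hx : x ∈ Ioo a y) :
    kPrabhakarIntegral k ρ β₁ γ₁ ω a (kPrabhakarIntegral k ρ β₂ γ₂ ω a f) x =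
      kPrabhakarIntegral k ρ (β₁ + β₂) (γ₁ + γ₂) ω a f x := by
  obtain ⟨T, rfl⟩ : ∃ T, y = a + T := ⟨y - a, by ring⟩
  exact volterra_volterra (continuousIntegrableOn_kPrabhakarKernel hk hρ h₁ γ₁ ω T)
    (continuousIntegrableOn_kPrabhakarKernel hk hρ h₂ γ₂ ω T) hf
    (fun u hu => volterra_kPrabhakarKernel hk hρ h₁ h₂ γ₁ γ₂ ω hu.1) hx

theorem volterra_congr {a x : ℝ} {K L f g : ℝ → ℂ} (hx : a ≤ x) (hK : EqOn K L (Ioi 0))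
    (hf : EqOn f g (Ioo a x)) : volterra K a f x = volterra L a g x := by
  rw [volterra, volterra, intervalIntegral.integral_of_le hx, intervalIntegral.integral_of_le hx,
    integral_Ioc_eq_integral_Ioo, integral_Ioc_eq_integral_Ioo]
  refine setIntegral_congr_fun measurableSet_Ioo fun t ht => ?_
  rw [hK (sub_pos.2 ht.2), hf ht]

theorem kPrabhakarIntegral_congr (k : ℝ) (ρ β γ ω : ℂ) {a x : ℝ} {f g : ℝ → ℂ} (hx : a ≤ x)
    (hf : EqOn f g (Ioo a x)) :
    kPrabhakarIntegral k ρ β γ ω a f x = kPrabhakarIntegral k ρ β γ ω a g x :=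
  volterra_congr hx (fun _ _ => rfl) hf

theorem kPrabhakarIntegral_const_mul (k : ℝ) (ρ β γ ω c : ℂ) (a x : ℝ) (f : ℝ → ℂ) :
    kPrabhakarIntegral k ρ β γ ω a (fun t => c * f t) x =
      c * kPrabhakarIntegral k ρ β γ ω a f x := by
  simp only [kPrabhakarIntegral, ← intervalIntegral.integral_const_mul]
  congr 1
  funext t
  ring

/-! ### The case γ = 0: iterated integrals -/

theorem kPrabhakarKernel_zero_right {k : ℝ} (hk : 0 < k) {ρ : ℂ} (hρ : 0 < ρ.re) (ω : ℂ) (n : ℕ)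
    {t : ℝ} (ht : 0 < t) :
    kPrabhakarKernel k ρ (((n + 1 : ℕ) : ℂ) * k) 0 ω t =
      ((k : ℂ) ^ (n + 1))⁻¹ * ((t : ℂ) ^ n / (n.factorial : ℂ)) := by
  have hk' : (k : ℂ) ≠ 0 := by exact_mod_cast hk.ne'
  have hβ : 0 < (((n + 1 : ℕ) : ℂ) * k).re := by
    rw [Complex.re_mul_ofReal, Complex.natCast_re]; positivity
  refine (hasSum_kPrabhakarKernel hk hρ hβ 0 ω ht).unique ?_
  have hv : kPochhammer k 0 0 / (Nat.factorial 0 : ℂ) * (ω ^ 0 *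
      riemannLiouvilleKernel k ((ρ * ((0 : ℕ) : ℂ) + ((n + 1 : ℕ) : ℂ) * k) / k) t) =
      ((k : ℂ) ^ (n + 1))⁻¹ * ((t : ℂ) ^ n / (n.factorial : ℂ)) := by
    have e : (ρ * ((0 : ℕ) : ℂ) + ((n + 1 : ℕ) : ℂ) * k) / k = (n : ℂ) + 1 := by
      field_simp
      push_cast
      ring
    rw [e, riemannLiouvilleKernel, kPochhammer_zero, Complex.Gamma_nat_eq_factorial,
      add_sub_cancel_right, Complex.cpow_natCast, Complex.cpow_neg, ← Nat.cast_succ,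
      Complex.cpow_natCast]
    simp [mul_div_assoc]
  rw [← hv]
  refine hasSum_single 0 fun j hj => ?_
  obtain ⟨i, rfl⟩ := Nat.exists_eq_succ_of_ne_zero hj
  simp [kPochhammer_zero_left]

/-- The `n`-fold iterated integral with base point `a`. -/
noncomputable def iteratedIntegral (a : ℝ) (f : ℝ → ℂ) : ℕ → ℝ → ℂ
  | 0 => f
  | n + 1 => fun x => ∫ t in a..x, iteratedIntegral a f n t

/-- For β = k and γ = 0 the kernel is the constant 1/k; the semigroup law splits off one such
integration at a time. -/
theorem pow_mul_kPrabhakarIntegral_eq_iteratedIntegral {k : ℝ} (hk : 0 < k) {ρ : ℂ}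
    (hρ : 0 < ρ.re) (ω : ℂ) {a y : ℝ} {f : ℝ → ℂ} (hf : ContinuousIntegrableOn f (Ioo a y))
    (n : ℕ) {x : ℝ} (hx : x ∈ Ioo a y) :
    (k : ℂ) ^ (n + 1) * kPrabhakarIntegral k ρ (((n + 1 : ℕ) : ℂ) * k) 0 ω a f x =
      iteratedIntegral a f (n + 1) x := by
  have hk' : (k : ℂ) ≠ 0 := by exact_mod_cast hk.ne'
  have hβ : ∀ n : ℕ, 0 < (((n + 1 : ℕ) : ℂ) * k).re := fun n => by
    rw [Complex.re_mul_ofReal, Complex.natCast_re]; positivity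
  have base : ∀ (g : ℝ → ℂ) {x : ℝ}, x ∈ Ioo a y →
      (k : ℂ) * kPrabhakarIntegral k ρ (((0 + 1 : ℕ) : ℂ) * k) 0 ω a g x = ∫ t in a..x, g t :=
    fun g x hx => by
      have : kPrabhakarIntegral k ρ (((0 + 1 : ℕ) : ℂ) * k) 0 ω a g x =
          volterra (fun _ => (k : ℂ)⁻¹) a g x :=
        volterra_congr hx.1.le (fun t ht => by
          rw [kPrabhakarKernel_zero_right hk hρ ω 0 ht]; simp) fun _ _ => rfl
      rw [this, volterra, intervalIntegral.integral_const_mul, mul_inv_cancel_left₀ hk']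
  induction n generalizing x with
  | zero => rw [zero_add, pow_one]; exact base f hx
  | succ n ih =>
    have e : (((n + 1 + 1 : ℕ) : ℂ) * k) = ((0 + 1 : ℕ) : ℂ) * k + ((n + 1 : ℕ) : ℂ) * k := by
      push_cast; ring
    have h := kPrabhakarIntegral_kPrabhakarIntegral hk hρ (hβ 0) (hβ n) 0 0 ω hf hx
    rw [add_zero] at h
    rw [e, ← h, pow_succ, mul_assoc, base _ hx, ← intervalIntegral.integral_const_mul]
    change _ = ∫ t in a..x, iteratedIntegral a f (n + 1) t
    rw [intervalIntegral.integral_of_le hx.1.le,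
      intervalIntegral.integral_of_le hx.1.le]
    refine setIntegral_congr_fun measurableSet_Ioc fun t ht => ?_
    exact ih ⟨ht.1, ht.2.trans_lt hx.2⟩

theorem ContinuousIntegrableOn.iteratedIntegral {a y : ℝ} {f : ℝ → ℂ}
    (hf : ContinuousIntegrableOn f (Ioo a y)) (n : ℕ) :
    ContinuousIntegrableOn (iteratedIntegral a f n) (Ioo a y) := by
  obtain ⟨T, rfl⟩ : ∃ T, y = a + T := ⟨y - a, by ring⟩
  induction n with
  | zero => exact hf
  | succ n ih =>
    have h1 : ContinuousIntegrableOn (fun _ => (1 : ℂ)) (Ioo 0 T) :=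
      ⟨continuousOn_const, integrableOn_const (by simp)⟩
    refine (h1.volterra ih).congr measurableSet_Ioo fun x _ => ?_
    simp [_root_.iteratedIntegral, _root_.volterra]

theorem hasDerivAt_iteratedIntegral {a y : ℝ} {f : ℝ → ℂ}
    (hf : ContinuousIntegrableOn f (Ioo a y)) (n : ℕ) {x : ℝ} (hx : x ∈ Ioo a y) :
    HasDerivAt (iteratedIntegral a f (n + 1)) (iteratedIntegral a f n x) x := by
  have h := hf.iteratedIntegral n
  refine intervalIntegral.integral_hasDerivAt_right ?_
    (h.1.stronglyMeasurableAtFilter isOpen_Ioo x hx) (h.1.continuousAt (isOpen_Ioo.mem_nhds hx))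
  rw [intervalIntegrable_iff_integrableOn_Ioo_of_le hx.1.le]
  exact h.2.mono_set (Ioo_subset_Ioo_right hx.2.le)

/-! ### Chains of derivatives and the open interval -/

theorem iteratedDeriv_eqOn_of_hasDerivAt {s : Set ℝ} (hs : IsOpen s) {u : ℕ → ℝ → ℂ} {m : ℕ}
    (hu : ∀ n < m, ∀ x ∈ s, HasDerivAt (u n) (u (n + 1) x) x) {F : ℝ → ℂ} (hF : EqOn F (u 0) s) :
    ∀ n ≤ m, EqOn (iteratedDeriv n F) (u n) s := by
  intro n
  induction n with
  | zero => intro _; simpa using hF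
  | succ n ih =>
    intro hn x hx
    rw [iteratedDeriv_succ]
    have h : iteratedDeriv n F =ᶠ[𝓝 x] u n :=
      (ih (Nat.le_of_succ_le hn)).eventuallyEq_of_mem (hs.mem_nhds hx)
    rw [h.deriv_eq, (hu n hn x hx).deriv]

theorem differentiableOn_iteratedDeriv_of_hasDerivAt {s : Set ℝ} (hs : IsOpen s)
    {u : ℕ → ℝ → ℂ} {m : ℕ} (hu : ∀ n < m, ∀ x ∈ s, HasDerivAt (u n) (u (n + 1) x) x)
    {F : ℝ → ℂ} (hF : EqOn F (u 0) s) {n : ℕ} (hn : n < m) :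
    DifferentiableOn ℝ (iteratedDeriv n F) s := fun x hx =>
  ((hu n hn x hx).differentiableAt.differentiableWithinAt).congr
    (iteratedDeriv_eqOn_of_hasDerivAt hs hu hF n hn.le)
    (iteratedDeriv_eqOn_of_hasDerivAt hs hu hF n hn.le hx)

theorem isOpen_openInterval (a : ℝ) (b : EReal) : IsOpen (openInterval a b) :=
  (isOpen_Ioi (a := a)).inter (isOpen_Iio.preimage continuous_coe_real_ereal)

theorem Ioo_subset_openInterval (a : ℝ) {b : EReal} {y : ℝ} (hy : (y : EReal) ≤ b) :
    Ioo a y ⊆ openInterval a b := fun _ ht =>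
  ⟨ht.1, (EReal.coe_lt_coe_iff.2 ht.2).trans_le hy⟩

/-- The operators at x involve only values on (a, x), so pointwise claims on an interval that may be
infinite reduce to a bounded one. -/
theorem exists_mem_Ioo_of_mem_openInterval {a : ℝ} {b : EReal} {x : ℝ}
    (hx : x ∈ openInterval a b) : ∃ y : ℝ, x ∈ Ioo a y ∧ Ioo a y ⊆ openInterval a b := by
  obtain ⟨y, h1, h2⟩ := EReal.lt_iff_exists_real_btwn.1 hx.2
  exact ⟨y, ⟨hx.1, EReal.coe_lt_coe_iff.1 h1⟩, Ioo_subset_openInterval a h2.le⟩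

theorem ordConnected_openInterval (a : ℝ) (b : EReal) : OrdConnected (openInterval a b) :=
  ⟨fun _ hx _ hy _ hz =>
    ⟨hx.1.trans_le hz.1, (EReal.coe_le_coe_iff.2 hz.2).trans_lt hy.2⟩⟩

/-! ### The derivative as a left inverse -/

theorem kPrabhakarOrder_pos (k : ℝ) (β : ℂ) : 0 < kPrabhakarOrder k β := Nat.succ_pos _

theorem re_order_mul_sub_pos {k : ℝ} (hk : 0 < k) (β : ℂ) :
    0 < ((kPrabhakarOrder k β : ℂ) * k - β).re := by
  have h : β.re / k < (kPrabhakarOrder k β : ℝ) := by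
    rw [kPrabhakarOrder]; push_cast; exact Nat.lt_floor_add_one _
  rw [div_lt_iff₀ hk] at h
  rw [Complex.sub_re, Complex.re_mul_ofReal, Complex.natCast_re]
  linarith

theorem order_sub_one_mul_le_re {k : ℝ} (hk : 0 < k) {β : ℂ} (hβ : 0 < β.re) :
    ((kPrabhakarOrder k β : ℝ) - 1) * k ≤ β.re := by
  have h : (⌊β.re / k⌋₊ : ℝ) ≤ β.re / k := Nat.floor_le (div_nonneg hβ.le hk.le)
  rw [le_div_iff₀ hk] at h
  simpa [kPrabhakarOrder] using h

theorem kPrabhakarPrimitive_kPrabhakarIntegral {k : ℝ} (hk : 0 < k) {ρ β : ℂ} (hρ : 0 < ρ.re)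
    (hβ : 0 < β.re) (γ ω : ℂ) {a y : ℝ} {f : ℝ → ℂ} (hf : ContinuousIntegrableOn f (Ioo a y))
    {x : ℝ} (hx : x ∈ Ioo a y) :
    kPrabhakarPrimitive k ρ β γ ω a (kPrabhakarIntegral k ρ β γ ω a f) x =
      iteratedIntegral a f (kPrabhakarOrder k β) x := by
  rw [kPrabhakarPrimitive, kPrabhakarIntegral_kPrabhakarIntegral hk hρ
    (re_order_mul_sub_pos hk β) hβ _ _ ω hf hx, neg_add_cancel, sub_add_cancel]
  exact pow_mul_kPrabhakarIntegral_eq_iteratedIntegral hk hρ ω hf ⌊β.re / k⌋₊ hx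

theorem kPrabhakarDeriv_kPrabhakarIntegral {k : ℝ} (hk : 0 < k) {ρ β : ℂ} (hρ : 0 < ρ.re)
    (hβ : 0 < β.re) (γ ω : ℂ) {a : ℝ} {b : EReal} {f : ℝ → ℂ}
    (hf : ContinuousIntegrableOn f (openInterval a b)) :
    KPrabhakarDifferentiableOn k ρ β γ ω a (kPrabhakarIntegral k ρ β γ ω a f)
        (openInterval a b) ∧
      ∀ x ∈ openInterval a b,
        kPrabhakarDeriv k ρ β γ ω a (kPrabhakarIntegral k ρ β γ ω a f) x = f x := by
  have hu : ∀ n < kPrabhakarOrder k β, ∀ x ∈ openInterval a b,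
      HasDerivAt (iteratedIntegral a f (kPrabhakarOrder k β - n))
        (iteratedIntegral a f (kPrabhakarOrder k β - (n + 1)) x) x := fun n hn x hx => by
    obtain ⟨y, hxy, hy⟩ := exists_mem_Ioo_of_mem_openInterval hx
    have := hasDerivAt_iteratedIntegral (hf.mono hy) (kPrabhakarOrder k β - (n + 1)) hxy
    rwa [show kPrabhakarOrder k β - (n + 1) + 1 = kPrabhakarOrder k β - n by omega] at this
  have hF : EqOn (kPrabhakarPrimitive k ρ β γ ω a (kPrabhakarIntegral k ρ β γ ω a f))
      (iteratedIntegral a f (kPrabhakarOrder k β - 0)) (openInterval a b) := fun x hx => by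
    obtain ⟨y, hxy, hy⟩ := exists_mem_Ioo_of_mem_openInterval hx
    exact kPrabhakarPrimitive_kPrabhakarIntegral hk hρ hβ γ ω (hf.mono hy) hxy
  refine ⟨⟨fun x hx => ?_, fun i hi => ?_⟩, fun x hx => ?_⟩
  · obtain ⟨y, hxy, hy⟩ := exists_mem_Ioo_of_mem_openInterval hx
    exact kPrabhakarIntegrableAt_of_mem_Ioo hk hρ (re_order_mul_sub_pos hk β) _ ω
      ((hf.mono hy).kPrabhakarIntegral hk hρ hβ γ ω) hxy
  · exact differentiableOn_iteratedDeriv_of_hasDerivAt (isOpen_openInterval a b)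
      (u := fun n => iteratedIntegral a f (kPrabhakarOrder k β - n)) hu hF hi
  · have := iteratedDeriv_eqOn_of_hasDerivAt (isOpen_openInterval a b)
      (u := fun n => iteratedIntegral a f (kPrabhakarOrder k β - n)) hu hF _ le_rfl hx
    simp only [Nat.sub_self] at this
    exact this

/-! ### Boundary values, polynomials and injectivity -/

/-- For Re β ≥ k the kernel is bounded on bounded intervals, so the integral is dominated by a
multiple of the integral of |f| over (a, x). -/
theorem tendsto_kPrabhakarIntegral_nhdsGT_zero {k : ℝ} (hk : 0 < k) {ρ β : ℂ} (hρ : 0 < ρ.re)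
    (hβ : k ≤ β.re) (γ ω : ℂ) {a y : ℝ} (hay : a < y) {f : ℝ → ℂ}
    (hf : IntegrableOn f (Ioo a y)) :
    Tendsto (kPrabhakarIntegral k ρ β γ ω a f) (𝓝[>] a) (𝓝 0) := by
  obtain ⟨C, hC0, hC⟩ := exists_norm_kPrabhakarKernel_le hk hρ (hk.trans_le hβ) γ ω (y - a)
  have he : 0 ≤ β.re / k - 1 := sub_nonneg.2 ((one_le_div hk).2 hβ)
  set D := C * (y - a) ^ (β.re / k - 1) with hD
  set g : ℝ → ℝ := (Ioo a y).indicator fun t => ‖f t‖ with hg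
  have hfn : IntegrableOn (fun t => ‖f t‖) (Ioo a y) := hf.norm
  have hgi : Integrable g := hfn.integrable_indicator measurableSet_Ioo
  have hlim : Tendsto (fun x => ∫ t in a..x, D * g t) (𝓝[>] a) (𝓝 0) := by
    have := (intervalIntegral.continuous_primitive
      (fun b c => (hgi.const_mul D).intervalIntegrable (a := b) (b := c)) a).tendsto a
    rw [intervalIntegral.integral_same] at this
    exact this.mono_left nhdsWithin_le_nhds
  refine squeeze_zero_norm' ?_ hlim
  filter_upwards [Ioo_mem_nhdsGT hay] with x hx
  refine intervalIntegral.norm_integral_le_of_norm_le hx.1.le (ae_of_all _ fun t ht => ?_)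
    (hgi.const_mul D).intervalIntegrable
  rw [norm_mul, hg, indicator_of_mem (show t ∈ Ioo a y from ⟨ht.1, ht.2.trans_lt hx.2⟩)]
  refine mul_le_mul_of_nonneg_right ?_ (norm_nonneg _)
  rcases ht.2.eq_or_lt with h | h
  · have : 0 ≤ (y - a) ^ (β.re / k - 1) := Real.rpow_nonneg (by linarith) _
    simp only [h, sub_self, kPrabhakarKernel, lt_irrefl, if_false, norm_zero, hD]
    positivity
  · refine (hC (x - t) ⟨sub_pos.2 h, by linarith [ht.1, hx.2]⟩).trans ?_
    exact mul_le_mul_of_nonneg_left (Real.rpow_le_rpow (sub_pos.2 h).le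
      (by linarith [ht.1, hx.2]) he) hC0

theorem exists_eq_sum_pow_of_hasDerivAt {s : Set ℝ} (hs : OrdConnected s) (hs' : IsOpen s)
    (a : ℝ) (m : ℕ) {u : ℕ → ℝ → ℂ}
    (hu : ∀ n < m, ∀ x ∈ s, HasDerivAt (u n) (u (n + 1) x) x) (hm : ∀ x ∈ s, u m x = 0) :
    ∃ d : ℕ → ℂ, ∀ x ∈ s, u 0 x = ∑ j ∈ Finset.range m, d j * ((x - a : ℝ) : ℂ) ^ j := by
  induction m generalizing u with
  | zero => exact ⟨0, fun x hx => by simpa using hm x hx⟩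
  | succ m ih =>
    obtain ⟨d, hd⟩ := ih (u := fun n => u (n + 1))
      (fun n hn x hx => hu (n + 1) (Nat.succ_lt_succ hn) x hx) hm
    set G : ℝ → ℂ := fun x => u 0 x -
      ∑ j ∈ Finset.range m, d j / ((j + 1 : ℕ) : ℂ) * ((x - a : ℝ) : ℂ) ^ (j + 1) with hG
    have hder : ∀ x ∈ s, HasDerivAt G 0 x := fun x hx => by
      have h1 : HasDerivAt (fun x : ℝ => ((x - a : ℝ) : ℂ)) 1 x := by
        simpa using ((hasDerivAt_id x).sub_const a).ofReal_comp
      have h2 : HasDerivAt (fun x : ℝ => ∑ j ∈ Finset.range m,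
          d j / ((j + 1 : ℕ) : ℂ) * ((x - a : ℝ) : ℂ) ^ (j + 1))
          (∑ j ∈ Finset.range m, d j * ((x - a : ℝ) : ℂ) ^ j) x := by
        refine HasDerivAt.fun_sum fun j _ => ?_
        convert! (h1.pow (j + 1)).const_mul (d j / ((j + 1 : ℕ) : ℂ)) using 1
        have : ((j + 1 : ℕ) : ℂ) ≠ 0 := by exact_mod_cast j.succ_ne_zero
        simp only [Nat.add_sub_cancel, mul_one]
        field_simp
      have h3 := (hu 0 m.succ_pos x hx).sub h2
      rwa [hd x hx, sub_self] at h3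
    have hconst : ∃ c, ∀ x ∈ s, G x = c := by
      rcases s.eq_empty_or_nonempty with rfl | ⟨x₀, hx₀⟩
      · exact ⟨0, by simp⟩
      · exact ⟨G x₀, fun x hx => hs'.is_const_of_deriv_eq_zero hs.isPreconnected
          (fun z hz => (hder z hz).differentiableAt.differentiableWithinAt)
          (fun z hz => (hder z hz).deriv) hx hx₀⟩
    obtain ⟨c, hc⟩ := hconst
    -- Integrating the polynomial of the derivative shifts its coefficients by one; c is the
    -- constant of integration.
    refine ⟨fun j => if j = 0 then c else d (j - 1) / (j : ℂ), fun x hx => ?_⟩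
    rw [Finset.sum_range_succ', ← hc x hx]
    simp [hG]

theorem eqOn_zero_of_iteratedIntegral_eq_zero {a y : ℝ} {f : ℝ → ℂ}
    (hf : ContinuousIntegrableOn f (Ioo a y)) (n : ℕ)
    (h : EqOn (iteratedIntegral a f n) 0 (Ioo a y)) : EqOn f 0 (Ioo a y) := by
  induction n with
  | zero => exact h
  | succ n ih =>
    refine ih fun x hx => ?_
    have h1 : iteratedIntegral a f (n + 1) =ᶠ[𝓝 x] fun _ => 0 :=
      h.eventuallyEq_of_mem (isOpen_Ioo.mem_nhds hx)
    rw [← (hasDerivAt_iteratedIntegral hf n hx).deriv, h1.deriv_eq]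
    simp

/-- Applying P^γ_β to the vanishing primitive shows that an iterated integral of f vanishes, and
differentiation then gives f = 0. -/
theorem eqOn_zero_of_kPrabhakarPrimitive_eq_zero {k : ℝ} (hk : 0 < k) {ρ β : ℂ} (hρ : 0 < ρ.re)
    (hβ : 0 < β.re) (γ ω : ℂ) {a y : ℝ} {f : ℝ → ℂ} (hf : ContinuousIntegrableOn f (Ioo a y))
    (h : EqOn (kPrabhakarPrimitive k ρ β γ ω a f) 0 (Ioo a y)) : EqOn f 0 (Ioo a y) := by
  have hk' : (k : ℂ) ≠ 0 := by exact_mod_cast hk.ne'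
  refine eqOn_zero_of_iteratedIntegral_eq_zero hf (⌊β.re / k⌋₊ + 1) fun x hx => ?_
  rw [← pow_mul_kPrabhakarIntegral_eq_iteratedIntegral hk hρ ω hf _ hx]
  have e := kPrabhakarIntegral_kPrabhakarIntegral hk hρ hβ (re_order_mul_sub_pos hk β) γ (-γ) ω
    hf hx
  rw [add_neg_cancel, add_sub_cancel, kPrabhakarOrder] at e
  rw [← e, kPrabhakarIntegral_congr k ρ β γ ω hx.1.le (g := fun _ => 0)]
  · simp [kPrabhakarIntegral]
  · intro t ht
    have := h ⟨ht.1, ht.2.trans hx.2⟩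
    simpa [kPrabhakarPrimitive, kPrabhakarOrder, hk'] using this

theorem kPrabhakarIntegral_sub {k : ℝ} (hk : 0 < k) {ρ β : ℂ} (hρ : 0 < ρ.re)
    (hβ : 0 < β.re) (γ ω : ℂ) {a y x : ℝ} {f g : ℝ → ℂ} (hf : ContinuousIntegrableOn f (Ioo a y))
    (hg : ContinuousIntegrableOn g (Ioo a y)) (hx : x ∈ Ioo a y) :
    kPrabhakarIntegral k ρ β γ ω a (fun t => f t - g t) x =
      kPrabhakarIntegral k ρ β γ ω a f x - kPrabhakarIntegral k ρ β γ ω a g x := by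
  simp only [kPrabhakarIntegral, mul_sub]
  exact intervalIntegral.integral_sub (kPrabhakarIntegrableAt_of_mem_Ioo hk hρ hβ γ ω hf hx)
    (kPrabhakarIntegrableAt_of_mem_Ioo hk hρ hβ γ ω hg hx)

theorem kPrabhakarIntegral_sum {k : ℝ} (hk : 0 < k) {ρ β : ℂ} (hρ : 0 < ρ.re)
    (hβ : 0 < β.re) (γ ω : ℂ) {a y x : ℝ} {ι : Type*} (s : Finset ι) {f : ι → ℝ → ℂ}
    (hf : ∀ i ∈ s, ContinuousIntegrableOn (f i) (Ioo a y)) (hx : x ∈ Ioo a y) :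
    kPrabhakarIntegral k ρ β γ ω a (fun t => ∑ i ∈ s, f i t) x =
      ∑ i ∈ s, kPrabhakarIntegral k ρ β γ ω a (f i) x := by
  simp only [kPrabhakarIntegral, Finset.mul_sum]
  exact intervalIntegral.integral_finsetSum fun i hi =>
    kPrabhakarIntegrableAt_of_mem_Ioo hk hρ hβ γ ω (hf i hi) hx

theorem ContinuousIntegrableOn.sub {f g : ℝ → ℂ} {s : Set ℝ} (hf : ContinuousIntegrableOn f s)
    (hg : ContinuousIntegrableOn g s) : ContinuousIntegrableOn (fun t => f t - g t) s :=
  ⟨hf.1.sub hg.1, hf.2.sub hg.2⟩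

theorem ContinuousIntegrableOn.const_mul {f : ℝ → ℂ} {s : Set ℝ}
    (hf : ContinuousIntegrableOn f s) (c : ℂ) : ContinuousIntegrableOn (fun t => c * f t) s :=
  ⟨continuousOn_const.mul hf.1, hf.2.const_mul c⟩

theorem ContinuousIntegrableOn.sum {ι : Type*} {f : ι → ℝ → ℂ} {u : Finset ι} {s : Set ℝ}
    (hf : ∀ i ∈ u, ContinuousIntegrableOn (f i) s) :
    ContinuousIntegrableOn (fun t => ∑ i ∈ u, f i t) s :=
  ⟨continuousOn_finsetSum _ fun i hi => (hf i hi).1,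
    integrable_finsetSum _ fun i hi => (hf i hi).2⟩

theorem continuousIntegrableOn_kPrabhakarKernel_sub {k : ℝ} (hk : 0 < k) {ρ β : ℂ}
    (hρ : 0 < ρ.re) (hβ : 0 < β.re) (γ ω : ℂ) (a y : ℝ) :
    ContinuousIntegrableOn (fun t => kPrabhakarKernel k ρ β γ ω (t - a)) (Ioo a y) := by
  have h := continuousIntegrableOn_kPrabhakarKernel hk hρ hβ γ ω (y - a)
  refine ⟨h.1.comp (by fun_prop) fun t ht => ⟨by linarith [ht.1], by linarith [ht.2]⟩, ?_⟩
  rcases le_total y a with hya | hay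
  · simp [Ioo_eq_empty_of_le hya]
  rw [← intervalIntegrable_iff_integrableOn_Ioo_of_le hay]
  have h2 := (intervalIntegrable_iff_integrableOn_Ioo_of_le (sub_nonneg.2 hay)).2 h.2
  simpa using h2.comp_sub_right a

/-- The orders mk - β and β - ik add up to (n + 1)k while -γ and γ cancel, leaving the kernel of an
iterated integral. These functions are the preimages of the monomials. -/
theorem kPrabhakarPrimitive_kernel {k : ℝ} (hk : 0 < k) {ρ β : ℂ} (hρ : 0 < ρ.re)
    (γ ω : ℂ) {i n : ℕ} (hin : i + (n + 1) = kPrabhakarOrder k β)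
    (hi : 0 < (β - (i : ℂ) * k).re) {a x : ℝ} (hx : a < x) :
    kPrabhakarPrimitive k ρ β γ ω a
        (fun t => kPrabhakarKernel k ρ (β - (i : ℂ) * k) γ ω (t - a)) x =
      (k : ℂ) ^ i * (((x - a : ℝ) : ℂ) ^ n / (n.factorial : ℂ)) := by
  have hk' : (k : ℂ) ≠ 0 := by exact_mod_cast hk.ne'
  have e := volterra_comp_sub (kPrabhakarKernel k ρ ((kPrabhakarOrder k β : ℂ) * k - β) (-γ) ω)
    (kPrabhakarKernel k ρ (β - (i : ℂ) * k) γ ω) a x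
  rw [volterra_kPrabhakarKernel hk hρ (re_order_mul_sub_pos hk β) hi _ _ ω (sub_pos.2 hx),
    neg_add_cancel, show ((kPrabhakarOrder k β : ℂ) * k - β + (β - (i : ℂ) * k)) =
      ((n + 1 : ℕ) : ℂ) * k by rw [← hin]; push_cast; ring,
    kPrabhakarKernel_zero_right hk hρ ω n (sub_pos.2 hx)] at e
  rw [kPrabhakarPrimitive, kPrabhakarIntegral]
  rw [volterra] at e
  rw [e, ← hin, pow_add]
  field_simp

theorem kPrabhakarPrimitive_const_mul (k : ℝ) (ρ β γ ω c : ℂ) (a x : ℝ) (f : ℝ → ℂ) :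
    kPrabhakarPrimitive k ρ β γ ω a (fun t => c * f t) x =
      c * kPrabhakarPrimitive k ρ β γ ω a f x := by
  rw [kPrabhakarPrimitive, kPrabhakarIntegral_const_mul, kPrabhakarPrimitive, mul_left_comm]

theorem exists_kPrabhakarPrimitive_eq_sum_pow {k : ℝ} (hk : 0 < k) {ρ β : ℂ} (hρ : 0 < ρ.re)
    (γ ω : ℂ) {a : ℝ} {b : EReal} (hab : (a : EReal) < b) {f : ℝ → ℂ}
    (hf : ContinuousIntegrableOn f (openInterval a b))
    (hd : KPrabhakarDifferentiableOn k ρ β γ ω a f (openInterval a b))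
    (hφ : ContinuousIntegrableOn (kPrabhakarDeriv k ρ β γ ω a f) (openInterval a b)) :
    ∃ d : ℕ → ℂ, (β.re = ((kPrabhakarOrder k β : ℝ) - 1) * k → d 0 = 0) ∧
      ∀ x ∈ openInterval a b, kPrabhakarPrimitive k ρ β γ ω a f x -
        iteratedIntegral a (kPrabhakarDeriv k ρ β γ ω a f) (kPrabhakarOrder k β) x =
          ∑ j ∈ Finset.range (kPrabhakarOrder k β), d j * ((x - a : ℝ) : ℂ) ^ j := by
  set m := kPrabhakarOrder k β with hm
  set φ := kPrabhakarDeriv k ρ β γ ω a f with hφ'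
  set F := kPrabhakarPrimitive k ρ β γ ω a f with hF
  have hS := isOpen_openInterval a b
  obtain ⟨d, hd'⟩ := exists_eq_sum_pow_of_hasDerivAt (ordConnected_openInterval a b) hS a m
    (u := fun n x => iteratedDeriv n F x - iteratedIntegral a φ (m - n) x)
    (fun n hn x hx => by
      obtain ⟨y, hxy, hy⟩ := exists_mem_Ioo_of_mem_openInterval hx
      have h1 := hasDerivAt_iteratedIntegral (hφ.mono hy) (m - (n + 1)) hxy
      rw [show m - (n + 1) + 1 = m - n by omega] at h1
      have h2 := ((hd.2 n hn).differentiableAt (hS.mem_nhds hx)).hasDerivAt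
      rw [← iteratedDeriv_succ] at h2
      exact h2.sub h1)
    (fun x _ => by
      simp only [Nat.sub_self]
      exact sub_self _)
  refine ⟨d, fun hcrit => ?_, fun x hx => by
    simpa only [iteratedDeriv_zero, Nat.sub_zero] using hd' x hx⟩
  obtain ⟨y, hay, hyb⟩ := EReal.lt_iff_exists_real_btwn.1 hab
  have hay : a < y := EReal.coe_lt_coe_iff.1 hay
  have hy := Ioo_subset_openInterval a hyb.le
  have t1 : Tendsto F (𝓝[>] a) (𝓝 0) := by
    have h : k ≤ ((kPrabhakarOrder k β : ℂ) * k - β).re := by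
      rw [Complex.sub_re, Complex.re_mul_ofReal, Complex.natCast_re, hcrit]
      apply le_of_eq; ring
    have := (tendsto_kPrabhakarIntegral_nhdsGT_zero hk hρ h (-γ) ω hay
      (hf.mono hy).2).const_mul ((k : ℂ) ^ m)
    rwa [mul_zero] at this
  have t2 : Tendsto (iteratedIntegral a φ m) (𝓝[>] a) (𝓝 0) := by
    -- The m-fold integral is k^m times a Prabhakar integral of order mk ≥ k with γ = 0, so the same
    -- boundary lemma applies.
    have h : k ≤ (((⌊β.re / k⌋₊ + 1 : ℕ) : ℂ) * k).re := by
      rw [Complex.re_mul_ofReal, Complex.natCast_re]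
      push_cast
      nlinarith [Nat.cast_nonneg (α := ℝ) ⌊β.re / k⌋₊]
    have := (tendsto_kPrabhakarIntegral_nhdsGT_zero hk hρ h 0 ω hay
      (hφ.mono hy).2).const_mul ((k : ℂ) ^ m)
    rw [mul_zero] at this
    refine this.congr' ?_
    filter_upwards [Ioo_mem_nhdsGT hay] with x hx
    exact pow_mul_kPrabhakarIntegral_eq_iteratedIntegral hk hρ ω (hφ.mono hy) _ hx
  have t3 : Tendsto (fun x : ℝ => ∑ j ∈ Finset.range m, d j * ((x - a : ℝ) : ℂ) ^ j) (𝓝[>] a)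
      (𝓝 (d 0)) := by
    have hc : Continuous fun x : ℝ => ∑ j ∈ Finset.range m, d j * ((x - a : ℝ) : ℂ) ^ j := by
      fun_prop
    have := hc.tendsto a
    have e : ∑ j ∈ Finset.range m, d j * ((a - a : ℝ) : ℂ) ^ j = d 0 := by
      rw [Finset.sum_eq_single_of_mem 0 (Finset.mem_range.2 (kPrabhakarOrder_pos k β))]
      · simp
      · intro j _ hj
        simp [hj]
    rw [e] at this
    exact this.mono_left nhdsWithin_le_nhds
  have t4 := t1.sub t2
  rw [sub_zero] at t4
  refine tendsto_nhds_unique (t3.congr' ?_) t4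
  filter_upwards [Ioo_mem_nhdsGT hay] with x hx
  rw [← hd' x (hy hx)]
  simp

/-! ### The formula for the integral of the derivative -/

theorem exists_kPrabhakarIntegral_kPrabhakarDeriv_eq {k : ℝ} (hk : 0 < k) {ρ β : ℂ}
    (hρ : 0 < ρ.re) (hβ : 0 < β.re) (γ ω : ℂ) {a : ℝ} {b : EReal} (hab : (a : EReal) < b)
    {f : ℝ → ℂ} (hf : ContinuousIntegrableOn f (openInterval a b))
    (hd : KPrabhakarDifferentiableOn k ρ β γ ω a f (openInterval a b))
    (hφ : ContinuousIntegrableOn (kPrabhakarDeriv k ρ β γ ω a f) (openInterval a b)) :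
    ∃ c : ℕ → ℂ, (β.re = ((kPrabhakarOrder k β : ℝ) - 1) * k → c (kPrabhakarOrder k β - 1) = 0) ∧
      ∀ x ∈ openInterval a b,
        kPrabhakarIntegral k ρ β γ ω a (kPrabhakarDeriv k ρ β γ ω a f) x =
          f x + ∑ j ∈ Finset.range (kPrabhakarOrder k β),
            c j * (((x - a : ℝ) : ℂ) ^ (β / k - 1 - (j : ℂ)) *
              kMittagLeffler k ρ (β - (j : ℂ) * k) γ (ω * ((x - a : ℝ) : ℂ) ^ (ρ / k))) := by
  have hk' : (k : ℂ) ≠ 0 := by exact_mod_cast hk.ne'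
  obtain ⟨d, hd0, hdx⟩ := exists_kPrabhakarPrimitive_eq_sum_pow hk hρ γ ω hab hf hd hφ
  set m := kPrabhakarOrder k β with hm
  set φ := kPrabhakarDeriv k ρ β γ ω a f with hφ'
  -- Chosen to undo the factor k^i / (m-1-i)!, so that the primitive of `G i` is exactly the
  -- monomial of degree m-1-i in the polynomial.
  set e : ℕ → ℂ := fun i => d (m - 1 - i) * ((m - 1 - i).factorial : ℂ) / (k : ℂ) ^ i with he
  set G : ℕ → ℝ → ℂ := fun i t =>
    e i * kPrabhakarKernel k ρ (β - (i : ℂ) * k) γ ω (t - a) with hG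
  have hpos : 0 < m := kPrabhakarOrder_pos k β
  -- Either the kernel in `G i` is integrable, or Re β = (m-1)k and i = m-1, when the coefficient is
  -- a multiple of d 0 = 0.
  have hcases : ∀ i < m, e i = 0 ∨ 0 < (β - (i : ℂ) * k).re := fun i hi => by
    rw [Complex.sub_re, Complex.re_mul_ofReal, Complex.natCast_re, sub_pos]
    have h1 := order_sub_one_mul_le_re hk hβ
    rw [← hm] at h1
    rcases (Nat.le_sub_one_of_lt hi).lt_or_eq with h | h
    · right
      have : (i : ℝ) < (m : ℝ) - 1 := by
        rw [lt_sub_iff_add_lt]; exact_mod_cast (by omega : i + 1 < m)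
      nlinarith
    · have hi' : (i : ℝ) = (m : ℝ) - 1 := by rw [h, Nat.cast_sub hpos, Nat.cast_one]
      rcases h1.eq_or_lt with h2 | h2
      · left
        simp only [he, h, Nat.sub_self, hd0 h2.symm, zero_mul, zero_div]
      · right
        rwa [hi']
  have hGi : ∀ i < m, ∀ y, ContinuousIntegrableOn (G i) (Ioo a y) := fun i hi y => by
    rcases hcases i hi with h | h
    · simp only [hG, h, zero_mul]
      exact ⟨continuousOn_const, integrableOn_zero⟩
    · exact (continuousIntegrableOn_kPrabhakarKernel_sub hk hρ h γ ω a y).const_mul _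
  have hGp : ∀ i < m, ∀ x, a < x → kPrabhakarPrimitive k ρ β γ ω a (G i) x =
      d (m - 1 - i) * ((x - a : ℝ) : ℂ) ^ (m - 1 - i) := fun i hi x hx => by
    have hf0 : ((m - 1 - i).factorial : ℂ) ≠ 0 := by exact_mod_cast (Nat.factorial_ne_zero _)
    rw [kPrabhakarPrimitive_const_mul]
    rcases hcases i hi with h | h
    · have : d (m - 1 - i) = 0 := by simpa [he, hf0, hk'] using h
      rw [h, this, zero_mul, zero_mul]
    · rw [kPrabhakarPrimitive_kernel hk hρ γ ω (n := m - 1 - i) (by omega) h hx, he]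
      field_simp
  have key : ∀ x ∈ openInterval a b, f x - kPrabhakarIntegral k ρ β γ ω a φ x -
      ∑ i ∈ Finset.range m, G i x = 0 := fun x hx => by
    obtain ⟨y, hxy, hy⟩ := exists_mem_Ioo_of_mem_openInterval hx
    have hP := (hφ.mono hy).kPrabhakarIntegral hk hρ hβ γ ω
    have hGs : ContinuousIntegrableOn (fun t => ∑ i ∈ Finset.range m, G i t) (Ioo a y) :=
      ContinuousIntegrableOn.sum fun i hi => hGi i (Finset.mem_range.1 hi) y
    refine eqOn_zero_of_kPrabhakarPrimitive_eq_zero hk hρ hβ γ ω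
      (((hf.mono hy).sub hP).sub hGs) (fun z hz => ?_) hxy
    have hr := re_order_mul_sub_pos hk β
    have h1 := kPrabhakarPrimitive_kPrabhakarIntegral hk hρ hβ γ ω (hφ.mono hy) hz
    have h2 := hdx z (hy hz)
    -- The polynomial is summed backwards because index i belongs to degree m-1-i.
    rw [← Finset.sum_range_reflect, ← h1] at h2
    rw [kPrabhakarPrimitive, kPrabhakarIntegral_sub hk hρ hr _ ω ((hf.mono hy).sub hP) hGs hz,
      kPrabhakarIntegral_sub hk hρ hr _ ω (hf.mono hy) hP hz,
      kPrabhakarIntegral_sum hk hρ hr _ ω _ (fun i hi => hGi i (Finset.mem_range.1 hi) y) hz,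
      mul_sub, mul_sub, Finset.mul_sum]
    refine sub_eq_zero.2 (h2.trans (Finset.sum_congr rfl fun i hi => ?_))
    exact (hGp i (Finset.mem_range.1 hi) z hz.1).symm
  -- The factor 1/k comes from the kernel, and the sign from solving for P φ.
  refine ⟨fun j => -(e j / k), fun hcrit => ?_, fun x hx => ?_⟩
  · simp [he, hd0 hcrit]
  · have hx' : 0 < x - a := sub_pos.2 hx.1
    have h := key x hx
    rw [sub_eq_zero] at h
    have h3 : kPrabhakarIntegral k ρ β γ ω a φ x = f x - ∑ i ∈ Finset.range m, G i x := by
      rw [← h]; ring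
    rw [h3, sub_eq_add_neg, ← Finset.sum_neg_distrib]
    congr 1
    refine Finset.sum_congr rfl fun j _ => ?_
    simp only [hG]
    rw [kPrabhakarKernel_of_pos _ _ _ _ _ hx', sub_div, mul_div_cancel_right₀ _ hk',
      sub_right_comm]
    ring

/-! ### Reality of the constants -/

theorem conj_ofReal_cpow {x : ℝ} (hx : 0 < x) (s : ℂ) :
    conj ((x : ℂ) ^ s) = (x : ℂ) ^ conj s := by
  rw [Complex.cpow_conj, Complex.conj_ofReal]
  rw [Complex.arg_ofReal_of_nonneg hx.le]
  exact Real.pi_ne_zero.symm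

theorem conj_kMittagLeffler {k : ℝ} (hk : 0 < k) (ρ β γ z : ℂ) :
    conj (kMittagLeffler k ρ β γ z) = kMittagLeffler k (conj ρ) (conj β) (conj γ) (conj z) := by
  rw [kMittagLeffler, kMittagLeffler, Complex.conj_tsum]
  refine tsum_congr fun n => ?_
  simp [kPochhammer, kGamma, conj_ofReal_cpow hk, ← Complex.Gamma_conj]

theorem conj_cpow_mul_kMittagLeffler {k : ℝ} (hk : 0 < k) {ρ β γ ω : ℂ} (hρ : conj ρ = ρ)
    (hβ : conj β = β) (hγ : conj γ = γ) (hω : conj ω = ω) {s : ℂ} (hs : conj s = s) {t : ℝ}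
    (ht : 0 < t) :
    conj ((t : ℂ) ^ s * kMittagLeffler k ρ β γ (ω * (t : ℂ) ^ (ρ / k))) =
      (t : ℂ) ^ s * kMittagLeffler k ρ β γ (ω * (t : ℂ) ^ (ρ / k)) := by
  simp [conj_kMittagLeffler hk, conj_ofReal_cpow ht, hρ, hβ, hγ, hω, hs]

theorem conj_kPrabhakarIntegral {k : ℝ} (hk : 0 < k) {ρ β γ ω : ℂ} (hρ : conj ρ = ρ)
    (hβ : conj β = β) (hγ : conj γ = γ) (hω : conj ω = ω) {a x : ℝ} (hx : a < x) {f : ℝ → ℂ}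
    (hf : ∀ t ∈ Ioo a x, conj (f t) = f t) :
    conj (kPrabhakarIntegral k ρ β γ ω a f x) = kPrabhakarIntegral k ρ β γ ω a f x := by
  rw [kPrabhakarIntegral, intervalIntegral.integral_of_le hx.le, integral_Ioc_eq_integral_Ioo,
    ← integral_conj]
  refine setIntegral_congr_fun measurableSet_Ioo fun t ht => ?_
  have h := conj_cpow_mul_kMittagLeffler hk hρ hβ hγ hω (s := β / k - 1) (by simp [hβ])
    (sub_pos.2 ht.2)
  rw [kPrabhakarKernel_of_pos _ _ _ _ _ (sub_pos.2 ht.2), div_mul_eq_mul_div, map_mul, map_div₀,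
    h, hf t ht, Complex.conj_ofReal]

theorem conj_iteratedDeriv {s : Set ℝ} (hs : IsOpen s) {F : ℝ → ℂ}
    (hF : ∀ x ∈ s, conj (F x) = F x) (n : ℕ) :
    ∀ x ∈ s, conj (iteratedDeriv n F x) = iteratedDeriv n F x := by
  induction n with
  | zero => simpa using hF
  | succ n ih =>
    intro x hx
    have h : (fun y => star (iteratedDeriv n F y)) =ᶠ[𝓝 x] iteratedDeriv n F := by
      filter_upwards [hs.mem_nhds hx] with y hy using ih y hy
    rw [iteratedDeriv_succ]
    have := h.deriv_eq
    rwa [deriv.star] at this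

theorem conj_kPrabhakarDeriv {k : ℝ} (hk : 0 < k) {ρ β γ ω : ℂ} (hρ : conj ρ = ρ)
    (hβ : conj β = β) (hγ : conj γ = γ) (hω : conj ω = ω) {a : ℝ} {b : EReal} {f : ℝ → ℂ}
    (hf : ∀ t ∈ openInterval a b, conj (f t) = f t) :
    ∀ x ∈ openInterval a b,
      conj (kPrabhakarDeriv k ρ β γ ω a f x) = kPrabhakarDeriv k ρ β γ ω a f x := by
  refine conj_iteratedDeriv (isOpen_openInterval a b) (fun x hx => ?_) _
  rw [kPrabhakarPrimitive, map_mul, map_pow, Complex.conj_ofReal,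
    conj_kPrabhakarIntegral hk hρ (by simp [hβ]) (by simp [hγ]) hω hx.1]
  exact fun t ht => hf t (Ioo_subset_openInterval a hx.2.le ht)

/-- All quantities except the coefficients are real, so taking real parts affects only the
coefficients. -/
theorem eq_add_sum_re_mul {m : ℕ} {z w : ℂ} {c q : ℕ → ℂ} (hz : z.im = 0) (hw : w.im = 0)
    (hq : ∀ j, (q j).im = 0) (h : z = w + ∑ j ∈ Finset.range m, c j * q j) :
    z = w + ∑ j ∈ Finset.range m, ((c j).re : ℂ) * q j := by
  apply Complex.ext
  · rw [h]
    simp [hq]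
  · simp [hz, hw, hq]

theorem proposition1 (k : ℝ) (hk : 0 < k) (ρ β γ ω : ℂ) (hρ : 0 < ρ.re) (hβ : 0 < β.re)
    (a : ℝ) (b : EReal) (hab : (a : EReal) < b) :
    (∀ f : ℝ → ℂ, ContinuousIntegrableOn f (openInterval a b) →
      (∀ x ∈ openInterval a b, KPrabhakarIntegrableAt k ρ β γ ω a f x) ∧
      (∀ y : ℝ, (y : EReal) ≤ b →
        IntegrableOn (kPrabhakarIntegral k ρ β γ ω a f) (Ioo a y) volume) ∧
      KPrabhakarDifferentiableOn k ρ β γ ω a (kPrabhakarIntegral k ρ β γ ω a f)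
        (openInterval a b) ∧
      ∀ x ∈ openInterval a b,
        kPrabhakarDeriv k ρ β γ ω a (kPrabhakarIntegral k ρ β γ ω a f) x = f x) ∧
    (∀ f : ℝ → ℂ, ContinuousIntegrableOn f (openInterval a b) →
      KPrabhakarDifferentiableOn k ρ β γ ω a f (openInterval a b) →
      ContinuousIntegrableOn (kPrabhakarDeriv k ρ β γ ω a f) (openInterval a b) →
      (∀ x ∈ openInterval a b,
        KPrabhakarIntegrableAt k ρ β γ ω a (kPrabhakarDeriv k ρ β γ ω a f) x) ∧
      ∃ c : ℕ → ℂ,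
        (β.re = ((kPrabhakarOrder k β : ℝ) - 1) * k → c (kPrabhakarOrder k β - 1) = 0) ∧
        (ρ.im = 0 → β.im = 0 → γ.im = 0 → ω.im = 0 →
          (∀ x ∈ openInterval a b, (f x).im = 0) → ∀ j, (c j).im = 0) ∧
        ∀ x ∈ openInterval a b,
          kPrabhakarIntegral k ρ β γ ω a (kPrabhakarDeriv k ρ β γ ω a f) x =
            f x + ∑ j ∈ Finset.range (kPrabhakarOrder k β),
              c j * ((x - a : ℝ) : ℂ) ^ (β / k - 1 - (j : ℂ)) *
                kMittagLeffler k ρ (β - (j : ℂ) * k) γ (ω * ((x - a : ℝ) : ℂ) ^ (ρ / k))) := by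
  refine ⟨fun f hf => ⟨fun x hx => ?_, fun y hy => ?_, ?_⟩, fun f hf hd hφ => ⟨fun x hx => ?_, ?_⟩⟩
  · obtain ⟨y, hxy, hy⟩ := exists_mem_Ioo_of_mem_openInterval hx
    exact kPrabhakarIntegrableAt_of_mem_Ioo hk hρ hβ γ ω (hf.mono hy) hxy
  · exact ((hf.mono (Ioo_subset_openInterval a hy)).kPrabhakarIntegral hk hρ hβ γ ω).2
  · exact kPrabhakarDeriv_kPrabhakarIntegral hk hρ hβ γ ω hf
  · obtain ⟨y, hxy, hy⟩ := exists_mem_Ioo_of_mem_openInterval hx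
    exact kPrabhakarIntegrableAt_of_mem_Ioo hk hρ hβ γ ω (hφ.mono hy) hxy
  · obtain ⟨c, hc0, hc⟩ :=
      exists_kPrabhakarIntegral_kPrabhakarDeriv_eq hk hρ hβ γ ω hab hf hd hφ
    -- Taking real parts keeps a vanishing constant zero, so both normalisations hold at once.
    -- Outside the real case the reality clause is vacuous and c is kept.
    by_cases hreal : ρ.im = 0 ∧ β.im = 0 ∧ γ.im = 0 ∧ ω.im = 0 ∧
        ∀ x ∈ openInterval a b, (f x).im = 0
    · obtain ⟨h1, h2, h3, h4, h5⟩ := hreal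
      rw [← Complex.conj_eq_iff_im] at h1 h2 h3 h4
      refine ⟨fun j => ((c j).re : ℂ), fun hcrit => by simp [hc0 hcrit],
        fun _ _ _ _ _ j => Complex.ofReal_im _, fun x hx => ?_⟩
      simp only [mul_assoc]
      refine eq_add_sum_re_mul ?_ (h5 x hx) (fun j => ?_) (hc x hx)
      · rw [← Complex.conj_eq_iff_im]
        refine conj_kPrabhakarIntegral hk h1 h2 h3 h4 hx.1 fun t ht => ?_
        exact conj_kPrabhakarDeriv hk h1 h2 h3 h4
          (fun z hz => Complex.conj_eq_iff_im.2 (h5 z hz)) t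
          (Ioo_subset_openInterval a hx.2.le ht)
      · rw [← Complex.conj_eq_iff_im]
        exact conj_cpow_mul_kMittagLeffler hk h1 (by simp [h2]) h3 h4 (by simp [h2])
          (sub_pos.2 hx.1)
    · refine ⟨c, hc0, fun h1 h2 h3 h4 h5 => absurd ⟨h1, h2, h3, h4, h5⟩ hreal, fun x hx => ?_⟩
      simp only [mul_assoc]
      exact hc x hx
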